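/- **Theorem 3.2.** Let $n=1+n_1+n_2$ with $n_1,n_2\ge 1$, let $M^n$ be a smooth manifold and let $\psi:M^n\to\mathbb R^{n+1}$ be a locally strongly convex centroaffine hypersurface, i.e. a smooth immersion whose position vector is everywhere transversal to the tangent plane and for which there is $\varepsilon\in\{1,-1\}$ such that the centroaffine metric $h$ in the Gauss formula $$D_X\psi_*(Y)=\psi_*(\nabla_XY)+h(X,Y)(-\varepsilon\psi)$$ is positive definite ($D$ is the standard flat connection). Let $\hat\nabla$ be the Levi-Civita connection of $h$ and $K(X,Y)=\nabla_XY-\hat\nabla_XY$ the difference tensor. Assume that $\hat\nabla K=0$ and that there are a smooth vector field $T$ with $h(T,T)=1$ and distributions $\mathcal D_2,\mathcal D_3$ of dimensions $n_1,n_2$ such that $\mathcal D_1=\mathbb R T$, $\mathcal D_2$ and $\mathcal D_3$ are mutually $h$-orthogonal, and constants $\lambda_1,\lambda_2,\lambda_3$ with $$K(T,T)=\lambda_1T,\quad K(T,V)=\lambda_2V,\quad K(T,W)=\lambda_3W\qquad(V\in\mathcal D_2,\ W\in\mathcal D_3),$$ $$\lambda_1\ne2\lambda_2,\quad \lambda_1\ne2\lambda_3,\quad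 \lambda_2\ne\lambda_3.$$ Then $\psi$ is locally the Calabi product of two locally strongly convex centroaffine hypersurfaces $\psi_1:M_1^{n_1}\to\mathbb R^{n_1+1}$ and $\psi_2:M_2^{n_2}\to\mathbb R^{n_2+1}$ with parallel cubic form. That is, there is a constant $\lambda\ne0,-1$ such that every point of $M$ has an open neighbourhood diffeomorphic to some $J\times M_1\times M_2$, with $J\subseteq\mathbb R$ open and $M_i\subseteq\mathbb R^{n_i}$ open, on which, after a linear identification $\mathbb R^{n+1}\cong\mathbb R^{n_1+1}\times\mathbb R^{n_2+1}$, $$\psi(u,p,q)=\bigl(e^{u}\psi_1(p),\,e^{-\lambda u}\psi_2(q)\bigr),$$ where each $\psi_i$ is a locally strongly convex centroaffine hypersurface whose cubic form $C^i=\nabla^ih^i$ is parallel with respect to the Levi-Civita connection $\hat\nabla^i$ of its centroaffine metric $h^i$ (the sign $\varepsilon_i=\pm1$ being chosen so that $h^i$ is positive definite). -/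

import Mathlib

open scoped Manifold ContDiff

namespace Centroaffine

/-- The standard space `ℝⁿ`. -/
abbrev Euc (n : ℕ) : Type := EuclideanSpace ℝ (Fin n)

/-! ### Centroaffine invariants of a local parametrization `F` of a hypersurface of `ℝⁿ⁺¹`

`F` is considered near the point `x : ℝⁿ`; tangent vectors are written in the coordinates of `ℝⁿ`,
and the arguments `u v w z` are tangent vectors (constant coordinate vector fields). -/

noncomputable section LocalInvariants

variable {n : ℕ}

/-- The map `(v, c) ↦ dF(v) + c • (-ε F)` at `x`. It is an isomorphism `ℝⁿ × ℝ ≃ ℝⁿ⁺¹` exactly when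
`F` is immersed at `x` and its position vector is transversal to the tangent plane (`ε = ±1`). -/
def gaussFrame (ε : ℝ) (F : Euc n → Euc (n + 1)) (x : Euc n) : Euc n × ℝ →L[ℝ] Euc (n + 1) :=
  (fderiv ℝ F x).coprod (ContinuousLinearMap.toSpanSingleton ℝ (-(ε • F x)))

/-- The centroaffine metric `h`: the component of the second derivative of `F` along `-ε F` in the
Gauss formula `D_u dF(v) = dF(Γ(u, v)) + h(u, v) (-ε F)`. -/
def metric (ε : ℝ) (F : Euc n → Euc (n + 1)) (x : Euc n) : Euc n →L[ℝ] Euc n →L[ℝ] ℝ :=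
  (ContinuousLinearMap.compL ℝ (Euc n) (Euc (n + 1)) ℝ
    ((ContinuousLinearMap.snd ℝ (Euc n) ℝ).comp (gaussFrame ε F x).inverse)).comp
    (fderiv ℝ (fderiv ℝ F) x)

/-- The Christoffel symbol `Γ` of the induced connection `∇`: the tangential component of the second
derivative of `F` in the Gauss formula. Thus `∇_X Y = D_X Y + Γ(X, Y)` in coordinates. -/
def inducedConnection (ε : ℝ) (F : Euc n → Euc (n + 1)) (x : Euc n) :
    Euc n →L[ℝ] Euc n →L[ℝ] Euc n :=
  (ContinuousLinearMap.compL ℝ (Euc n) (Euc (n + 1)) (Euc n)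
    ((ContinuousLinearMap.fst ℝ (Euc n) ℝ).comp (gaussFrame ε F x).inverse)).comp
    (fderiv ℝ (fderiv ℝ F) x)

/-- The Christoffel symbol `Γ̂` of the Levi-Civita connection of a metric `g`, given by
`2 g(Γ̂(u, v), w) = ∂_u g(v, w) + ∂_v g(u, w) - ∂_w g(u, v)`. -/
def leviCivita (g : Euc n → Euc n →L[ℝ] Euc n →L[ℝ] ℝ) (x u v : Euc n) : Euc n :=
  (g x).inverse ((1 / 2 : ℝ) •
    (fderiv ℝ g x u v + fderiv ℝ g x v u - ((fderiv ℝ g x).flip u).flip v))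

/-- The Levi-Civita connection `∇̂` of the centroaffine metric. -/
def metricConnection (ε : ℝ) (F : Euc n → Euc (n + 1)) (x u v : Euc n) : Euc n :=
  leviCivita (metric ε F) x u v

/-- The difference tensor `K(u, v) = ∇_u v - ∇̂_u v`. -/
def differenceTensor (ε : ℝ) (F : Euc n → Euc (n + 1)) (x u v : Euc n) : Euc n :=
  inducedConnection ε F x u v - metricConnection ε F x u v

/-- `(∇̂_u K)(v, w) = ∇̂_u (K(v, w)) - K(∇̂_u v, w) - K(v, ∇̂_u w)`. -/
def covDerivDifferenceTensor (ε : ℝ) (F : Euc n → Euc (n + 1)) (x u v w : Euc n) : Euc n :=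
  fderiv ℝ (fun y => differenceTensor ε F y v w) x u
    + metricConnection ε F x u (differenceTensor ε F x v w)
    - differenceTensor ε F x (metricConnection ε F x u v) w
    - differenceTensor ε F x v (metricConnection ε F x u w)

/-- The cubic form `C = ∇h`, `C(u, v, w) = u(h(v, w)) - h(∇_u v, w) - h(v, ∇_u w)`. -/
def cubicForm (ε : ℝ) (F : Euc n → Euc (n + 1)) (x u v w : Euc n) : ℝ :=
  fderiv ℝ (fun y => metric ε F y v w) x u
    - metric ε F x (inducedConnection ε F x u v) w
    - metric ε F x v (inducedConnection ε F x u w)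

/-- `(∇̂_u C)(v, w, z) = u(C(v, w, z)) - C(∇̂_u v, w, z) - C(v, ∇̂_u w, z) - C(v, w, ∇̂_u z)`. -/
def covDerivCubicForm (ε : ℝ) (F : Euc n → Euc (n + 1)) (x u v w z : Euc n) : ℝ :=
  fderiv ℝ (fun y => cubicForm ε F y v w z) x u
    - cubicForm ε F x (metricConnection ε F x u v) w z
    - cubicForm ε F x v (metricConnection ε F x u w) z
    - cubicForm ε F x v w (metricConnection ε F x u z)

end LocalInvariants

/-! ### Centroaffine hypersurfaces `ψ : Mⁿ → ℝⁿ⁺¹`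

Tensors on `M` are read in the charts of the atlas; the conditions below are tensorial, so they do
not depend on the charts. -/

noncomputable section Hypersurfaces

variable {n : ℕ} {M : Type*} [TopologicalSpace M] [ChartedSpace (Euc n) M]

/-- `ψ` is a centroaffine hypersurface: a smooth immersion whose position vector is everywhere
transversal to the tangent plane. -/
structure IsCentroaffine (ψ : M → Euc (n + 1)) : Prop where
  smooth : ContMDiff (𝓡 n) (𝓡 (n + 1)) ∞ ψ
  immersion : ∀ p : M, Function.Injective (mfderiv (𝓡 n) (𝓡 (n + 1)) ψ p)
  transversal : ∀ p : M, ψ p ∉ Set.range (mfderiv (𝓡 n) (𝓡 (n + 1)) ψ p)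

/-- The centroaffine metric `h` of `ψ` on tangent vectors at `p`, computed in the chart `e`. -/
def metricAt (ε : ℝ) (ψ : M → Euc (n + 1)) (e : OpenPartialHomeomorph M (Euc n)) (p : M)
    (v w : TangentSpace (𝓡 n) p) : ℝ :=
  metric ε (ψ ∘ e.symm) (e p) (mfderiv (𝓡 n) (𝓡 n) e p v) (mfderiv (𝓡 n) (𝓡 n) e p w)

/-- `K(v, w) = z` for the difference tensor `K` of `ψ` and tangent vectors `v w z` at `p`, computed
in the chart `e`. -/
def DifferenceTensorEq (ε : ℝ) (ψ : M → Euc (n + 1)) (e : OpenPartialHomeomorph M (Euc n)) (p : M)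
    (v w z : TangentSpace (𝓡 n) p) : Prop :=
  differenceTensor ε (ψ ∘ e.symm) (e p) (mfderiv (𝓡 n) (𝓡 n) e p v) (mfderiv (𝓡 n) (𝓡 n) e p w) =
    mfderiv (𝓡 n) (𝓡 n) e p z

/-- `ψ` is a locally strongly convex centroaffine hypersurface, and `ε = ±1` is the sign for which
the centroaffine metric induced by the centroaffine normal `-ε ψ` is positive definite. -/
structure IsLocallyStronglyConvex (ε : ℝ) (ψ : M → Euc (n + 1)) : Prop where
  centroaffine : IsCentroaffine ψ
  sign : ε = 1 ∨ ε = -1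
  pos : ∀ e ∈ atlas (Euc n) M, ∀ x ∈ e.target, ∀ v : Euc n, v ≠ 0 →
    0 < metric ε (ψ ∘ e.symm) x v v

/-- The difference tensor is parallel: `∇̂K = 0`. -/
def HasParallelDifferenceTensor (ε : ℝ) (ψ : M → Euc (n + 1)) : Prop :=
  ∀ e ∈ atlas (Euc n) M, ∀ x ∈ e.target, ∀ u v w : Euc n,
    covDerivDifferenceTensor ε (ψ ∘ e.symm) x u v w = 0

/-- The cubic form is parallel: `∇̂C = 0`. -/
def HasParallelCubicForm (ε : ℝ) (ψ : M → Euc (n + 1)) : Prop :=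
  ∀ e ∈ atlas (Euc n) M, ∀ x ∈ e.target, ∀ u v w z : Euc n,
    covDerivCubicForm ε (ψ ∘ e.symm) x u v w z = 0

end Hypersurfaces

/-- The (generalized) Calabi product `(u, p, q) ↦ (e^u ψ₁(p), e^{-λu} ψ₂(q))` of `ψ₁` and `ψ₂`. -/
noncomputable def calabiProduct {M₁ M₂ : Type*} {n₁ n₂ : ℕ} (lam : ℝ) (ψ₁ : M₁ → Euc (n₁ + 1))
    (ψ₂ : M₂ → Euc (n₂ + 1)) (u : ℝ) (p : M₁) (q : M₂) : Euc (n₁ + 1) × Euc (n₂ + 1) :=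
  (Real.exp u • ψ₁ p, Real.exp (-lam * u) • ψ₂ q)

/-- Near the point `x`, the hypersurface `ψ : M → ℝⁿ⁺¹` is the Calabi product, with parameter `lam`,
of two locally strongly convex centroaffine hypersurfaces with parallel cubic form, of dimensions
`n₁` and `n₂`: there are such hypersurfaces `ψᵢ : Uᵢ → ℝ^(nᵢ+1)` on coordinate domains `Uᵢ ⊆ ℝ^(nᵢ)`
and a diffeomorphism `Φ` of some `J × U₁ × U₂`, `J ⊆ ℝ` open, onto an open neighbourhood of `x` such
that, after a linear identification `A` of `ℝⁿ⁺¹` with `ℝ^(n₁+1) × ℝ^(n₂+1)`, `ψ ∘ Φ` is the Calabi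
product of `ψ₁` and `ψ₂`. -/
def IsCalabiProductNear {n : ℕ} {M : Type*} [TopologicalSpace M] [ChartedSpace (Euc n) M]
    (n₁ n₂ : ℕ) (lam : ℝ) (ψ : M → Euc (n + 1)) (x : M) : Prop :=
  ∃ (J : TopologicalSpace.Opens ℝ) (U₁ : TopologicalSpace.Opens (Euc n₁))
    (U₂ : TopologicalSpace.Opens (Euc n₂))
    (ψ₁ : U₁ → Euc (n₁ + 1)) (ψ₂ : U₂ → Euc (n₂ + 1)) (ε₁ ε₂ : ℝ)
    (A : Euc (n + 1) ≃L[ℝ] Euc (n₁ + 1) × Euc (n₂ + 1))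
    (Φ : OpenPartialHomeomorph (ℝ × Euc n₁ × Euc n₂) M),
    IsLocallyStronglyConvex ε₁ ψ₁ ∧ HasParallelCubicForm ε₁ ψ₁ ∧
    IsLocallyStronglyConvex ε₂ ψ₂ ∧ HasParallelCubicForm ε₂ ψ₂ ∧
    ContMDiffOn 𝓘(ℝ, ℝ × Euc n₁ × Euc n₂) (𝓡 n) ∞ Φ Φ.source ∧
    ContMDiffOn (𝓡 n) 𝓘(ℝ, ℝ × Euc n₁ × Euc n₂) ∞ Φ.symm Φ.target ∧
    x ∈ Φ.target ∧
    Φ.source = (J : Set ℝ) ×ˢ (U₁ : Set (Euc n₁)) ×ˢ (U₂ : Set (Euc n₂)) ∧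
    ∀ u ∈ J, ∀ (p : U₁) (q : U₂),
      A (ψ (Φ (u, (p : Euc n₁), (q : Euc n₂)))) = calabiProduct lam ψ₁ ψ₂ u p q

end Centroaffine

/-! Work in a chart on a convex set, with a parametrization F, metric h, Levi-Civita symbol Γ̂,
difference tensor K and unit field τ; λᵢ stands for `lᵢ`.

Differentiating K(τ,τ) = λ₁τ with ∇̂K = 0 gives λ₁∇̂τ = 2K(τ,∇̂τ). As ∇̂τ is orthogonal to τ and λ₁
≠ 2λ₂, 2λ₃, the field τ is parallel (`fderiv_field`). Hence R̂(u,v)τ = 0, and the Gauss equation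
becomes algebra for K (`curvature_identity`): λ₂ and λ₃ are the two roots of X² − λ₁X + ε, so λ₁ =
λ₂ + λ₃ and λ₂λ₃ = ε, and K(D₂,D₃) = 0.

These relations say exactly that the vector-valued function dF(τ) satisfies the same Gauss formula
as F. Solutions of that linear system are linear images of F (`exists_eq_clm`), so dF(τ) = BF for a
constant endomorphism B of ℝⁿ⁺¹ (`exists_endomorphism`). B has only the eigenvalues λ₂ and λ₃, with
eigenspaces of dimensions n₁+1 and n₂+1; they provide the product decomposition of the ambient
space.

With dt = h(τ,·), the rescaled components exp(−λ₂t)A₁F and exp(−λ₃t)A₂F vary only along D₂ and only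
along D₃ (`hasFDerivAt_component`). Together with u = λ₂t they give local coordinates in which F is
a Calabi product with −λ = λ₃/λ₂. The slices p ↦ A₁F are treated in `IsLeaf`: the leaves are totally
geodesic, the induced metric is a constant multiple of h, and the cubic form is a multiple of
h(K·,·), so it is parallel. -/

namespace Centroaffine
-- Local centroaffine geometry: Gauss formula, Levi-Civita connection, Codazzi equation.
noncomputable section Param

set_option maxSynthPendingDepth 5

variable {n : ℕ}

/-- `F` is, on the open set `Ω`, a smooth parametrization of a centroaffine hypersurface with
positive definite centroaffine metric. -/
structure ConvexParam (ε : ℝ) (F : Euc n → Euc (n + 1)) (Ω : Set (Euc n)) : Prop where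
  isOpen : IsOpen Ω
  smooth : ContDiffOn ℝ ∞ F Ω
  frame : ∀ x ∈ Ω, (gaussFrame ε F x).IsInvertible
  pos : ∀ x ∈ Ω, ∀ v, v ≠ 0 → 0 < metric ε F x v v

theorem gaussFrame_apply (ε : ℝ) (F : Euc n → Euc (n + 1)) (x v : Euc n) (c : ℝ) :
    gaussFrame ε F x (v, c) = fderiv ℝ F x v + c • -(ε • F x) := by
  simp [gaussFrame]

theorem minSmoothness_two_le_infty : minSmoothness ℝ 2 ≤ ∞ := by
  simpa using (WithTop.coe_le_coe.2 le_top : ((2 : ℕ∞) : WithTop ℕ∞) ≤ ∞)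

theorem isInvertible_of_injective {V W : Type*} [NormedAddCommGroup V] [NormedSpace ℝ V]
    [NormedAddCommGroup W] [NormedSpace ℝ W] [FiniteDimensional ℝ V] [FiniteDimensional ℝ W]
    (f : V →L[ℝ] W) (hf : Function.Injective f)
    (h : Module.finrank ℝ V = Module.finrank ℝ W) : f.IsInvertible :=
  ⟨(LinearEquiv.ofInjectiveOfFinrankEq (f : V →ₗ[ℝ] W) hf h).toContinuousLinearEquiv, by
    ext v; rfl⟩

theorem isInvertible_gaussFrame {ε : ℝ} {F : Euc n → Euc (n + 1)} {x : Euc n}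
    (h : ∀ (v : Euc n) (c : ℝ), fderiv ℝ F x v + c • -(ε • F x) = 0 → v = 0 ∧ c = 0) :
    (gaussFrame ε F x).IsInvertible := by
  refine isInvertible_of_injective _ ((injective_iff_map_eq_zero _).2 ?_) (by simp)
  rintro ⟨v, c⟩ hvc
  rw [gaussFrame_apply] at hvc
  simpa using h v c hvc

/-- Uniqueness in the Gauss formula, since the frame is an isomorphism; the invariants of the
factors are later identified this way. -/
theorem gauss_components {ε : ℝ} {F : Euc n → Euc (n + 1)} {x : Euc n}
    (h : (gaussFrame ε F x).IsInvertible) {v w z : Euc n} {s : ℝ}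
    (he : fderiv ℝ (fderiv ℝ F) x v w = fderiv ℝ F x z + s • -(ε • F x)) :
    metric ε F x v w = s ∧ inducedConnection ε F x v w = z := by
  have : (gaussFrame ε F x).inverse (fderiv ℝ (fderiv ℝ F) x v w) = (z, s) := by
    rw [h.inverse_apply_eq, gaussFrame_apply, he]
  simp [metric, inducedConnection, this]

theorem gauss_formula {ε : ℝ} {F : Euc n → Euc (n + 1)} {x : Euc n}
    (h : (gaussFrame ε F x).IsInvertible) (v w : Euc n) :
    fderiv ℝ (fderiv ℝ F) x v w =
      fderiv ℝ F x (inducedConnection ε F x v w) + metric ε F x v w • -(ε • F x) := by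
  rw [← gaussFrame_apply]
  have := h.self_apply_inverse (fderiv ℝ (fderiv ℝ F) x v w)
  simpa [metric, inducedConnection] using this.symm

/-- `(u, v) ↦ Γ̂(u, v)` as a bilinear map. -/
def christoffel (g : Euc n → Euc n →L[ℝ] Euc n →L[ℝ] ℝ) (x : Euc n) :
    Euc n →L[ℝ] Euc n →L[ℝ] Euc n :=
  (ContinuousLinearMap.compL ℝ (Euc n) (Euc n →L[ℝ] ℝ) (Euc n) (g x).inverse).comp
    ((1 / 2 : ℝ) • (fderiv ℝ g x + (fderiv ℝ g x).flip -
      (((ContinuousLinearMap.flipₗᵢ ℝ (Euc n) (Euc n) ℝ).toContinuousLinearEquiv :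
        _ →L[ℝ] _).comp (fderiv ℝ g x).flip)))

theorem christoffel_apply (g : Euc n → Euc n →L[ℝ] Euc n →L[ℝ] ℝ) (x u v : Euc n) :
    christoffel g x u v = leviCivita g x u v := by
  change (g x).inverse _ = (g x).inverse _
  congr 1

/-- The difference tensor as a bilinear map. -/
def difference (ε : ℝ) (F : Euc n → Euc (n + 1)) (x : Euc n) :
    Euc n →L[ℝ] Euc n →L[ℝ] Euc n :=
  inducedConnection ε F x - christoffel (metric ε F) x

theorem difference_apply (ε : ℝ) (F : Euc n → Euc (n + 1)) (x u v : Euc n) :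
    difference ε F x u v = differenceTensor ε F x u v := by
  simp [difference, differenceTensor, metricConnection, christoffel_apply]

theorem christoffel_eq_metricConnection (ε : ℝ) (F : Euc n → Euc (n + 1)) (x u v : Euc n) :
    christoffel (metric ε F) x u v = metricConnection ε F x u v := by
  simp [metricConnection, christoffel_apply]

theorem inducedConnection_eq (ε : ℝ) (F : Euc n → Euc (n + 1)) (x u v : Euc n) :
    inducedConnection ε F x u v = christoffel (metric ε F) x u v + difference ε F x u v := by
  simp [difference]

namespace ConvexParam

variable {ε : ℝ} {F : Euc n → Euc (n + 1)} {Ω : Set (Euc n)} (H : ConvexParam ε F Ω)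
include H

theorem contDiffAt {x : Euc n} (hx : x ∈ Ω) : ContDiffAt ℝ ∞ F x :=
  H.smooth.contDiffAt (H.isOpen.mem_nhds hx)

theorem contDiffAt_fderiv {x : Euc n} (hx : x ∈ Ω) : ContDiffAt ℝ ∞ (fderiv ℝ F) x :=
  (H.contDiffAt hx).fderiv_right (by simp)

theorem contDiffAt_gaussFrame {x : Euc n} (hx : x ∈ Ω) : ContDiffAt ℝ ∞ (gaussFrame ε F) x := by
  have h1 : ContDiffAt ℝ ∞ (fun y => (fderiv ℝ F y).comp (ContinuousLinearMap.fst ℝ (Euc n) ℝ) +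
      (ContinuousLinearMap.toSpanSingletonLIE ℝ (Euc (n + 1)) (-(ε • F y))).comp
        (ContinuousLinearMap.snd ℝ (Euc n) ℝ)) x := by
    refine ((H.contDiffAt_fderiv hx).clm_comp contDiffAt_const).add ?_
    refine ContDiffAt.clm_comp ?_ contDiffAt_const
    exact (ContinuousLinearMap.toSpanSingletonLIE ℝ (Euc (n + 1))).contDiff.contDiffAt.comp x
      (((H.contDiffAt hx).const_smul ε).neg)
  refine h1.congr_of_eventuallyEq (Filter.Eventually.of_forall fun y => ?_)
  ext v <;> simp [gaussFrame]

theorem contDiffAt_frame_inverse {x : Euc n} (hx : x ∈ Ω) :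
    ContDiffAt ℝ ∞ (fun y => (gaussFrame ε F y).inverse) x :=
  ((H.frame x hx).contDiffAt_map_inverse).comp x (H.contDiffAt_gaussFrame hx)

theorem contDiffAt_metric {x : Euc n} (hx : x ∈ Ω) : ContDiffAt ℝ ∞ (metric ε F) x := by
  refine ContDiffAt.clm_comp ?_ ((H.contDiffAt_fderiv hx).fderiv_right (by simp))
  exact (ContinuousLinearMap.contDiff _).contDiffAt.comp x
    (contDiffAt_const.clm_comp (H.contDiffAt_frame_inverse hx))

theorem contDiffAt_inducedConnection {x : Euc n} (hx : x ∈ Ω) :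
    ContDiffAt ℝ ∞ (inducedConnection ε F) x := by
  refine ContDiffAt.clm_comp ?_ ((H.contDiffAt_fderiv hx).fderiv_right (by simp))
  exact (ContinuousLinearMap.contDiff _).contDiffAt.comp x
    (contDiffAt_const.clm_comp (H.contDiffAt_frame_inverse hx))

theorem isInvertible_metric {x : Euc n} (hx : x ∈ Ω) : (metric ε F x).IsInvertible := by
  refine isInvertible_of_injective _ ((injective_iff_map_eq_zero _).2 fun v hv => ?_) ?_
  · by_contra h
    have := H.pos x hx v h
    simp [hv] at this
  · rw [← LinearMap.toContinuousLinearMap.finrank_eq, Module.finrank_linearMap]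
    simp

theorem contDiffAt_christoffel {x : Euc n} (hx : x ∈ Ω) :
    ContDiffAt ℝ ∞ (christoffel (metric ε F)) x := by
  have hd : ContDiffAt ℝ ∞ (fderiv ℝ (metric ε F)) x :=
    (H.contDiffAt_metric hx).fderiv_right (by simp)
  have hf : ContDiffAt ℝ ∞ (fun y => (fderiv ℝ (metric ε F) y).flip) x :=
    (ContinuousLinearMap.flipₗᵢ ℝ (Euc n) (Euc n) (Euc n →L[ℝ] ℝ)).contDiff.contDiffAt.comp x hd
  refine ContDiffAt.clm_comp ?_ (((hd.add hf).sub (contDiffAt_const.clm_comp hf)).const_smul _)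
  exact (ContinuousLinearMap.contDiff _).contDiffAt.comp x
    ((H.isInvertible_metric hx).contDiffAt_map_inverse.comp x (H.contDiffAt_metric hx))

theorem contDiffAt_difference {x : Euc n} (hx : x ∈ Ω) : ContDiffAt ℝ ∞ (difference ε F) x :=
  (H.contDiffAt_inducedConnection hx).sub (H.contDiffAt_christoffel hx)

theorem isSymm_fderiv {x : Euc n} (hx : x ∈ Ω) (v w : Euc n) :
    fderiv ℝ (fderiv ℝ F) x v w = fderiv ℝ (fderiv ℝ F) x w v :=
  ((H.contDiffAt hx).isSymmSndFDerivAt minSmoothness_two_le_infty).eq v w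

theorem metric_comm {x : Euc n} (hx : x ∈ Ω) (v w : Euc n) :
    metric ε F x v w = metric ε F x w v := by
  simp [metric, H.isSymm_fderiv hx v w]

theorem inducedConnection_comm {x : Euc n} (hx : x ∈ Ω) (v w : Euc n) :
    inducedConnection ε F x v w = inducedConnection ε F x w v := by
  simp [inducedConnection, H.isSymm_fderiv hx v w]

theorem hasFDerivAt_metric {x : Euc n} (hx : x ∈ Ω) :
    HasFDerivAt (metric ε F) (fderiv ℝ (metric ε F) x) x :=
  ((H.contDiffAt_metric hx).differentiableAt (by simp)).hasFDerivAt

theorem fderiv_metric_comm {x : Euc n} (hx : x ∈ Ω) (u v w : Euc n) :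
    fderiv ℝ (metric ε F) x u v w = fderiv ℝ (metric ε F) x u w v := by
  have h := H.hasFDerivAt_metric hx
  have h1 := (h.clm_apply (hasFDerivAt_const v x)).clm_apply (hasFDerivAt_const w x)
  have h2 := (h.clm_apply (hasFDerivAt_const w x)).clm_apply (hasFDerivAt_const v x)
  have h3 := h1.congr_of_eventuallyEq (f₁ := fun y => metric ε F y w v)
    (Filter.eventually_of_mem (H.isOpen.mem_nhds hx) fun y hy => H.metric_comm hy w v)
  simpa using congrArg (fun L => L u) (h3.unique h2)

theorem metric_christoffel {x : Euc n} (hx : x ∈ Ω) (u v w : Euc n) :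
    metric ε F x (christoffel (metric ε F) x u v) w = (1 / 2) *
      (fderiv ℝ (metric ε F) x u v w + fderiv ℝ (metric ε F) x v u w
        - fderiv ℝ (metric ε F) x w u v) := by
  rw [christoffel_apply, leviCivita, (H.isInvertible_metric hx).self_apply_inverse]
  simp

theorem eq_of_metric_eq {x : Euc n} (hx : x ∈ Ω) {v w : Euc n}
    (h : ∀ z, metric ε F x v z = metric ε F x w z) : v = w :=
  (H.isInvertible_metric hx).injective (by ext z; exact h z)

theorem christoffel_comm {x : Euc n} (hx : x ∈ Ω) (u v : Euc n) :
    christoffel (metric ε F) x u v = christoffel (metric ε F) x v u := by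
  refine H.eq_of_metric_eq hx fun z => ?_
  rw [H.metric_christoffel hx, H.metric_christoffel hx, H.fderiv_metric_comm hx z u v]
  ring

/-- Metric compatibility ∇̂h = 0: the sum of two instances of the Koszul formula. -/
theorem fderiv_metric {x : Euc n} (hx : x ∈ Ω) (u v w : Euc n) :
    fderiv ℝ (metric ε F) x u v w =
      metric ε F x (christoffel (metric ε F) x u v) w
        + metric ε F x v (christoffel (metric ε F) x u w) := by
  rw [H.metric_comm hx v, H.metric_christoffel hx, H.metric_christoffel hx,
    H.fderiv_metric_comm hx v u w, H.fderiv_metric_comm hx w u v, H.fderiv_metric_comm hx u w v]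
  ring

theorem difference_comm {x : Euc n} (hx : x ∈ Ω) (u v : Euc n) :
    difference ε F x u v = difference ε F x v u := by
  simp [difference, H.christoffel_comm hx u v, H.inducedConnection_comm hx u v]

theorem frame_injective {x : Euc n} (hx : x ∈ Ω) {v w : Euc n} {c d : ℝ}
    (h : fderiv ℝ F x v + c • -(ε • F x) = fderiv ℝ F x w + d • -(ε • F x)) : v = w ∧ c = d := by
  rw [← gaussFrame_apply, ← gaussFrame_apply] at h
  simpa using (H.frame x hx).injective h

theorem hasFDerivAt_self {x : Euc n} (hx : x ∈ Ω) : HasFDerivAt F (fderiv ℝ F x) x :=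
  ((H.contDiffAt hx).differentiableAt (by simp)).hasFDerivAt

theorem hasFDerivAt_fderiv {x : Euc n} (hx : x ∈ Ω) :
    HasFDerivAt (fderiv ℝ F) (fderiv ℝ (fderiv ℝ F) x) x :=
  ((H.contDiffAt_fderiv hx).differentiableAt (by simp)).hasFDerivAt

/-- The Codazzi equation. -/
theorem metric_difference_comm {x : Euc n} (hx : x ∈ Ω) (u v w : Euc n) :
    metric ε F x u (difference ε F x v w) = metric ε F x v (difference ε F x u w) := by
  have hΓ : HasFDerivAt (inducedConnection ε F) (fderiv ℝ (inducedConnection ε F) x) x :=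
    ((H.contDiffAt_inducedConnection hx).differentiableAt (by simp)).hasFDerivAt
  have hD2 : HasFDerivAt (fderiv ℝ (fderiv ℝ F)) (fderiv ℝ (fderiv ℝ (fderiv ℝ F)) x) x :=
    (((H.contDiffAt_fderiv hx).fderiv_right (m := ∞) (by simp)).differentiableAt
      (by simp)).hasFDerivAt
  have hsymm : ∀ u v, fderiv ℝ (fderiv ℝ (fderiv ℝ F)) x u v
      = fderiv ℝ (fderiv ℝ (fderiv ℝ F)) x v u :=
    fun u v => ((H.contDiffAt_fderiv hx).isSymmSndFDerivAt minSmoothness_two_le_infty).eq u v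
  -- The Gauss formula differentiated once more. Symmetry of the third derivative is then compared
  -- along −εF only; after substituting Γ = Γ̂ + K, compatibility of Γ̂ with h cancels everything
  -- but the K terms.
  have key : ∀ u v, fderiv ℝ (fderiv ℝ (fderiv ℝ F)) x u v w =
      fderiv ℝ F x (inducedConnection ε F x u (inducedConnection ε F x v w)
        + fderiv ℝ (inducedConnection ε F) x u v w - (ε * metric ε F x v w) • u)
      + (metric ε F x u (inducedConnection ε F x v w) + fderiv ℝ (metric ε F) x u v w)
        • -(ε • F x) := by
    intro u v
    have h1 := (hD2.clm_apply (hasFDerivAt_const v x)).clm_apply (hasFDerivAt_const w x)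
    have h2 := ((H.hasFDerivAt_fderiv hx).clm_apply
      ((hΓ.clm_apply (hasFDerivAt_const v x)).clm_apply (hasFDerivAt_const w x))).add
      ((((H.hasFDerivAt_metric hx).clm_apply (hasFDerivAt_const v x)).clm_apply
        (hasFDerivAt_const w x)).smul ((H.hasFDerivAt_self hx).const_smul ε).neg)
    have h3 := h2.congr_of_eventuallyEq (f₁ := fun y => fderiv ℝ (fderiv ℝ F) y v w)
      (Filter.eventually_of_mem (H.isOpen.mem_nhds hx) fun y hy => gauss_formula (H.frame y hy) v w)
    have h4 := congrArg (fun L => L u) (h1.unique h3)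
    simp at h4
    rw [h4, gauss_formula (H.frame x hx) u]
    simp only [map_add, map_sub, map_smul]
    module
  have h := hsymm u v
  have h5 := congrArg (fun L => L w) h
  simp only [key] at h5
  have h6 := (H.frame_injective hx h5).2
  rw [H.fderiv_metric hx, H.fderiv_metric hx, inducedConnection_eq, inducedConnection_eq,
    H.christoffel_comm hx v u] at h6
  simp only [map_add] at h6
  linarith

theorem hasFDerivAt_difference {x : Euc n} (hx : x ∈ Ω) :
    HasFDerivAt (difference ε F) (fderiv ℝ (difference ε F) x) x :=
  ((H.contDiffAt_difference hx).differentiableAt (by simp)).hasFDerivAt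

/-- The condition ∇̂K = 0 solved for the coordinate derivative of K, ready for use in chain rules.
-/
theorem fderiv_difference {x : Euc n} (hx : x ∈ Ω) {u v w : Euc n}
    (hK : covDerivDifferenceTensor ε F x u v w = 0) :
    fderiv ℝ (difference ε F) x u v w =
      difference ε F x (christoffel (metric ε F) x u v) w
      + difference ε F x v (christoffel (metric ε F) x u w)
      - christoffel (metric ε F) x u (difference ε F x v w) := by
  have h1 := ((H.hasFDerivAt_difference hx).clm_apply (hasFDerivAt_const v x)).clm_apply
    (hasFDerivAt_const w x)
  have h2 : fderiv ℝ (fun y => differenceTensor ε F y v w) x u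
      = fderiv ℝ (difference ε F) x u v w := by
    simp only [← difference_apply]
    rw [h1.fderiv]
    simp
  rw [covDerivDifferenceTensor, h2] at hK
  simp only [← christoffel_eq_metricConnection, ← difference_apply] at hK
  rw [sub_sub, sub_eq_zero] at hK
  rw [← hK]
  abel

end ConvexParam

end Param
end Centroaffine

/-! ### The parallel field τ, the algebra of K, and the endomorphism B. -/

namespace Centroaffine
noncomputable section Splitting

set_option maxSynthPendingDepth 5

variable {n : ℕ}

/-- A map satisfying the same Gauss formula as `F` is a linear image of `F`. -/
theorem ConvexParam.exists_eq_clm {ε : ℝ} {F : Euc n → Euc (n + 1)} {Ω : Set (Euc n)}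
    (H : ConvexParam ε F Ω) (hε : ε ≠ 0) (hΩ : Convex ℝ Ω) {φ : Euc n → Euc (n + 1)}
    (hφ : ContDiffOn ℝ ∞ φ Ω)
    (hG : ∀ x ∈ Ω, ∀ u v, fderiv ℝ (fderiv ℝ φ) x u v =
      fderiv ℝ φ x (inducedConnection ε F x u v) + metric ε F x u v • -(ε • φ x)) :
    ∃ B : Euc (n + 1) →L[ℝ] Euc (n + 1), ∀ x ∈ Ω, φ x = B (F x) := by
  have hφ0 : ∀ x ∈ Ω, ContDiffAt ℝ ∞ φ x := fun x hx =>
    hφ.contDiffAt (H.isOpen.mem_nhds hx)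
  have hd : ∀ (f : Euc n → Euc (n + 1)) (x : Euc n), ContDiffAt ℝ ∞ f x →
      ∀ (v : Euc n) (c : ℝ),
      HasFDerivAt (fun y => gaussFrame ε f y (v, c))
        ((fderiv ℝ (fderiv ℝ f) x).flip v + c • -(ε • fderiv ℝ f x)) x := by
    intro f x hf v c
    have h1 : HasFDerivAt f (fderiv ℝ f x) x := (hf.differentiableAt (by simp)).hasFDerivAt
    have h2 : HasFDerivAt (fderiv ℝ f) (fderiv ℝ (fderiv ℝ f) x) x :=
      ((hf.fderiv_right (m := ∞) (by simp)).differentiableAt (by simp)).hasFDerivAt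
    simp only [gaussFrame_apply]
    refine ((h2.clm_apply (hasFDerivAt_const v x)).add
      ((h1.const_smul ε).neg.const_smul c)).congr_fderiv ?_
    ext; simp
  have hgφ : ∀ x ∈ Ω, ContDiffAt ℝ ∞ (gaussFrame ε φ) x := fun x hx => by
    have h1 : ContDiffAt ℝ ∞ (fun y =>
        (fderiv ℝ φ y).comp (ContinuousLinearMap.fst ℝ (Euc n) ℝ) +
        (ContinuousLinearMap.toSpanSingletonLIE ℝ (Euc (n + 1)) (-(ε • φ y))).comp
          (ContinuousLinearMap.snd ℝ (Euc n) ℝ)) x := by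
      refine (((hφ0 x hx).fderiv_right (by simp)).clm_comp contDiffAt_const).add ?_
      refine ContDiffAt.clm_comp ?_ contDiffAt_const
      exact (ContinuousLinearMap.toSpanSingletonLIE ℝ (Euc (n + 1))).contDiff.contDiffAt.comp x
        (((hφ0 x hx).const_smul ε).neg)
    refine h1.congr_of_eventuallyEq (Filter.Eventually.of_forall fun y => ?_)
    ext v <;> simp [gaussFrame]
  -- `B y` carries the frame (dF, −εF) to (dφ, −εφ). Both frames solve the same linear system, so
  -- the derivative of `B` vanishes.
  set B : Euc n → Euc (n + 1) →L[ℝ] Euc (n + 1) :=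
    fun y => (gaussFrame ε φ y).comp (gaussFrame ε F y).inverse with hB
  have hBF : ∀ y ∈ Ω, ∀ p, B y (gaussFrame ε F y p) = gaussFrame ε φ y p := fun y hy p => by
    simp [hB, (H.frame y hy).inverse_apply_self]
  have hBd : ∀ x ∈ Ω, HasFDerivAt (𝕜 := ℝ) B 0 x := by
    intro x hx
    have h1 : HasFDerivAt B (fderiv ℝ B x) x :=
      (((hgφ x hx).clm_comp (H.contDiffAt_frame_inverse hx)).differentiableAt
        (by simp)).hasFDerivAt
    suffices h0 : fderiv ℝ B x = 0 by rwa [h0] at h1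
    have key : ∀ u v c, fderiv ℝ B x u (gaussFrame ε F x (v, c)) = 0 := by
      intro u v c
      have h2 := h1.clm_apply (hd F x (H.contDiffAt hx) v c)
      have h3 := h2.congr_of_eventuallyEq (f₁ := fun y => gaussFrame ε φ y (v, c))
        (Filter.eventually_of_mem (H.isOpen.mem_nhds hx) fun y hy => (hBF y hy (v, c)).symm)
      have h4 := congrArg (fun L => L u) ((hd φ x (hφ0 x hx) v c).unique h3)
      have e1 : fderiv ℝ (fderiv ℝ φ) x u v + c • -(ε • fderiv ℝ φ x u) =
          gaussFrame ε φ x (inducedConnection ε F x u v - (c * ε) • u, metric ε F x u v) := by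
        rw [gaussFrame_apply, hG x hx, map_sub, map_smul]; module
      have e2 : fderiv ℝ (fderiv ℝ F) x u v + c • -(ε • fderiv ℝ F x u) =
          gaussFrame ε F x (inducedConnection ε F x u v - (c * ε) • u, metric ε F x u v) := by
        rw [gaussFrame_apply, gauss_formula (H.frame x hx), map_sub, map_smul]; module
      have h5 : fderiv ℝ (fderiv ℝ φ) x u v + c • -(ε • fderiv ℝ φ x u) =
          B x (fderiv ℝ (fderiv ℝ F) x u v + c • -(ε • fderiv ℝ F x u)) +
            fderiv ℝ B x u (gaussFrame ε F x (v, c)) := h4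
      rw [e1, e2, hBF x hx] at h5
      simpa using h5
    ext1 u
    ext1 p
    obtain ⟨⟨v, c⟩, rfl⟩ := (H.frame x hx).surjective p
    exact key u v c
  have hconst : ∀ x ∈ Ω, ∀ y ∈ Ω, B x = B y := fun x hx y hy =>
    hΩ.is_const_of_fderivWithin_eq_zero (𝕜 := ℝ)
      (fun z hz => (hBd z hz).differentiableAt.differentiableWithinAt)
      (fun z hz => by
        rw [fderivWithin_of_isOpen H.isOpen hz, (hBd z hz).fderiv]) hx hy
  have hval : ∀ x ∈ Ω, φ x = B x (F x) := fun x hx => by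
    -- The frame vector with coordinates (0, 1) is the transversal one, −εF.
    have := hBF x hx (0, 1)
    simp only [gaussFrame_apply, map_zero, zero_add, one_smul, map_neg, map_smul, neg_inj] at this
    exact (smul_right_injective _ hε this).symm
  rcases Ω.eq_empty_or_nonempty with h | ⟨x₀, hx₀⟩
  · exact ⟨0, by simp [h]⟩
  · exact ⟨B x₀, fun x hx => by rw [hval x hx, hconst x hx x₀ hx₀]⟩

/-- The difference tensor of `F` is parallel and splits along the unit vector field `τ` and the
orthogonal distributions `D₂`, `D₃`. -/
structure EigenSplitting (ε : ℝ) (F : Euc n → Euc (n + 1)) (Ω : Set (Euc n))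
    (τ : Euc n → Euc n) (D₂ D₃ : Euc n → Submodule ℝ (Euc n)) (n₁ n₂ : ℕ) (l₁ l₂ l₃ : ℝ) :
    Prop extends ConvexParam ε F Ω where
  sign : ε = 1 ∨ ε = -1
  parallel : ∀ x ∈ Ω, ∀ u v w, covDerivDifferenceTensor ε F x u v w = 0
  smooth_field : ContDiffOn ℝ ∞ τ Ω
  dim : 1 + n₁ + n₂ = n
  pos₁ : 1 ≤ n₁
  pos₂ : 1 ≤ n₂
  finrank₂ : ∀ x ∈ Ω, Module.finrank ℝ (D₂ x) = n₁
  finrank₃ : ∀ x ∈ Ω, Module.finrank ℝ (D₃ x) = n₂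
  unit : ∀ x ∈ Ω, metric ε F x (τ x) (τ x) = 1
  orth₂ : ∀ x ∈ Ω, ∀ v ∈ D₂ x, metric ε F x (τ x) v = 0
  orth₃ : ∀ x ∈ Ω, ∀ w ∈ D₃ x, metric ε F x (τ x) w = 0
  orth₂₃ : ∀ x ∈ Ω, ∀ v ∈ D₂ x, ∀ w ∈ D₃ x, metric ε F x v w = 0
  eigen₁ : ∀ x ∈ Ω, difference ε F x (τ x) (τ x) = l₁ • τ x
  eigen₂ : ∀ x ∈ Ω, ∀ v ∈ D₂ x, difference ε F x (τ x) v = l₂ • v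
  eigen₃ : ∀ x ∈ Ω, ∀ w ∈ D₃ x, difference ε F x (τ x) w = l₃ • w
  ne₁₂ : l₁ ≠ 2 * l₂
  ne₁₃ : l₁ ≠ 2 * l₃
  ne₂₃ : l₂ ≠ l₃

namespace EigenSplitting

variable {ε : ℝ} {F : Euc n → Euc (n + 1)} {Ω : Set (Euc n)} {τ : Euc n → Euc n}
  {D₂ D₃ : Euc n → Submodule ℝ (Euc n)} {n₁ n₂ : ℕ} {l₁ l₂ l₃ : ℝ}
  (S : EigenSplitting ε F Ω τ D₂ D₃ n₁ n₂ l₁ l₂ l₃)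
include S

/-- The two distributions play symmetric roles: each result on D₂ and λ₂ is transferred to D₃ and λ₃
through `S.swap`. -/
theorem swap : EigenSplitting ε F Ω τ D₃ D₂ n₂ n₁ l₁ l₃ l₂ :=
  { S with
    dim := by have := S.dim; omega
    pos₁ := S.pos₂
    pos₂ := S.pos₁
    finrank₂ := S.finrank₃
    finrank₃ := S.finrank₂
    orth₂ := S.orth₃
    orth₃ := S.orth₂
    orth₂₃ := fun x hx v hv w hw => by
      rw [S.metric_comm hx]; exact S.orth₂₃ x hx w hw v hv
    eigen₂ := S.eigen₃
    eigen₃ := S.eigen₂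
    ne₁₂ := S.ne₁₃
    ne₁₃ := S.ne₁₂
    ne₂₃ := S.ne₂₃.symm }

theorem mono {Ω' : Set (Euc n)} (hΩ' : IsOpen Ω') (h : Ω' ⊆ Ω) :
    EigenSplitting ε F Ω' τ D₂ D₃ n₁ n₂ l₁ l₂ l₃ where
  isOpen := hΩ'
  smooth := S.smooth.mono h
  frame := fun x hx => S.frame x (h hx)
  pos := fun x hx => S.pos x (h hx)
  sign := S.sign
  parallel := fun x hx => S.parallel x (h hx)
  smooth_field := S.smooth_field.mono h
  dim := S.dim
  pos₁ := S.pos₁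
  pos₂ := S.pos₂
  finrank₂ := fun x hx => S.finrank₂ x (h hx)
  finrank₃ := fun x hx => S.finrank₃ x (h hx)
  unit := fun x hx => S.unit x (h hx)
  orth₂ := fun x hx => S.orth₂ x (h hx)
  orth₃ := fun x hx => S.orth₃ x (h hx)
  orth₂₃ := fun x hx => S.orth₂₃ x (h hx)
  eigen₁ := fun x hx => S.eigen₁ x (h hx)
  eigen₂ := fun x hx => S.eigen₂ x (h hx)
  eigen₃ := fun x hx => S.eigen₃ x (h hx)
  ne₁₂ := S.ne₁₂
  ne₁₃ := S.ne₁₃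
  ne₂₃ := S.ne₂₃

theorem sign_ne_zero : ε ≠ 0 := by
  rcases S.sign with h | h <;> simp [h]

theorem eq_zero_of_metric_self {x : Euc n} (hx : x ∈ Ω) {v : Euc n}
    (h : metric ε F x v v = 0) : v = 0 := by
  by_contra hv
  exact (S.pos x hx v hv).ne' h

theorem components_eq_zero {x : Euc n} (hx : x ∈ Ω) {v w : Euc n} {c : ℝ} (hv : v ∈ D₂ x)
    (hw : w ∈ D₃ x) (h : c • τ x + v + w = 0) : c = 0 ∧ v = 0 ∧ w = 0 := by
  have e1 := congrArg (metric ε F x (τ x)) h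
  have e2 := congrArg (metric ε F x v) h
  have e3 := congrArg (metric ε F x w) h
  simp only [map_add, map_smul, S.unit x hx, S.orth₂ x hx v hv, S.orth₃ x hx w hw,
    S.orth₂₃ x hx v hv w hw, S.metric_comm hx v (τ x), S.metric_comm hx w (τ x),
    S.metric_comm hx w v, smul_eq_mul, map_zero, mul_zero, mul_one, add_zero, zero_add]
    at e1 e2 e3
  exact ⟨e1, S.eq_zero_of_metric_self hx e2, S.eq_zero_of_metric_self hx e3⟩

theorem exists_decomposition {x : Euc n} (hx : x ∈ Ω) (X : Euc n) :
    ∃ v ∈ D₂ x, ∃ w ∈ D₃ x, X = metric ε F x (τ x) X • τ x + v + w := by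
  let f : (ℝ × D₂ x × D₃ x) →ₗ[ℝ] Euc n :=
    (LinearMap.toSpanSingleton ℝ (Euc n) (τ x)).coprod ((D₂ x).subtype.coprod (D₃ x).subtype)
  have hf : ∀ c v w, f (c, v, w) = c • τ x + (v + w) := fun c v w => by simp [f]
  have hinj : Function.Injective f := by
    refine (injective_iff_map_eq_zero f).2 ?_
    rintro ⟨c, v, w⟩ h
    rw [hf, ← add_assoc] at h
    obtain ⟨h1, h2, h3⟩ := S.components_eq_zero hx v.2 w.2 h
    simp [h1, Subtype.ext_iff, h2, h3]
  have hsurj : Function.Surjective f := by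
    refine (LinearMap.injective_iff_surjective_of_finrank_eq_finrank ?_).1 hinj
    simp only [Module.finrank_prod, Module.finrank_self, S.finrank₂ x hx, S.finrank₃ x hx,
      finrank_euclideanSpace_fin]
    rw [← S.dim, add_assoc]
  obtain ⟨⟨c, v, w⟩, rfl⟩ := hsurj X
  refine ⟨v, v.2, w, w.2, ?_⟩
  rw [hf]
  simp [S.unit x hx, S.orth₂ x hx v v.2, S.orth₃ x hx w w.2, add_assoc]

theorem hasFDerivAt_field_self {x : Euc n} (hx : x ∈ Ω) :
    HasFDerivAt τ (fderiv ℝ τ x) x :=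
  ((S.smooth_field.contDiffAt (S.isOpen.mem_nhds hx)).differentiableAt (by simp)).hasFDerivAt

/-- The field `τ` is parallel. -/
theorem fderiv_field {x : Euc n} (hx : x ∈ Ω) (u : Euc n) :
    fderiv ℝ τ x u = -christoffel (metric ε F) x u (τ x) := by
  have hτ := S.hasFDerivAt_field_self hx
  have h1 := ((S.hasFDerivAt_difference hx).clm_apply hτ).clm_apply hτ
  have h2 := h1.congr_of_eventuallyEq (f₁ := fun y => l₁ • τ y)
    (Filter.eventually_of_mem (S.isOpen.mem_nhds hx) fun y hy => (S.eigen₁ y hy).symm)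
  have h3 := congrArg (fun L => L u) ((hτ.const_smul l₁).unique h2)
  have h4 := (((S.hasFDerivAt_metric hx).clm_apply hτ).clm_apply hτ)
  have h5 := h4.congr_of_eventuallyEq (f₁ := fun _ => (1 : ℝ))
    (Filter.eventually_of_mem (S.isOpen.mem_nhds hx) fun y hy => (S.unit y hy).symm)
  have h6 := congrArg (fun L => L u) ((hasFDerivAt_const (1 : ℝ) x).unique h5)
  simp [S.fderiv_difference hx (S.parallel x hx _ _ _), S.eigen₁ x hx] at h3
  simp [S.fderiv_metric hx] at h6
  -- Z = ∇̂_u τ. Unit length makes Z orthogonal to τ, and K(τ,τ) = λ₁τ gives λ₁Z = 2K(τ,Z); so λ₁ −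
  -- 2λ₂ and λ₁ − 2λ₃ annihilate its D₂ and D₃ parts.
  set Z := fderiv ℝ τ x u + christoffel (metric ε F) x u (τ x) with hZ
  have hZ1 : metric ε F x (τ x) Z = 0 := by
    rw [S.metric_comm hx _ (τ x), S.metric_comm hx _ (τ x)] at h6
    rw [hZ, map_add]; linarith
  have hZ2 : l₁ • Z = (2 : ℝ) • difference ε F x (τ x) Z := by
    rw [S.difference_comm hx _ (τ x), S.difference_comm hx _ (τ x)] at h3
    rw [hZ, map_add, smul_add, h3]
    module
  obtain ⟨v, hv, w, hw, hvw⟩ := S.exists_decomposition hx Z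
  rw [hZ1, zero_smul, zero_add] at hvw
  have hZ3 : (0 : ℝ) • τ x + (l₁ - 2 * l₂) • v + (l₁ - 2 * l₃) • w = 0 := by
    rw [hvw, map_add, S.eigen₂ x hx v hv, S.eigen₃ x hx w hw] at hZ2
    linear_combination (norm := module) hZ2
  obtain ⟨-, h7, h8⟩ := S.components_eq_zero hx ((D₂ x).smul_mem _ hv) ((D₃ x).smul_mem _ hw) hZ3
  have hv0 : v = 0 := (smul_eq_zero.1 h7).resolve_left (sub_ne_zero.2 S.ne₁₂)
  have hw0 : w = 0 := (smul_eq_zero.1 h8).resolve_left (sub_ne_zero.2 S.ne₁₃)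
  rw [eq_neg_iff_add_eq_zero, ← hZ, hvw, hv0, hw0, add_zero]

theorem hasFDerivAt_field {x : Euc n} (hx : x ∈ Ω) :
    HasFDerivAt τ (-(christoffel (metric ε F) x).flip (τ x)) x := by
  refine (S.hasFDerivAt_field_self hx).congr_fderiv ?_
  ext1 u
  simp [S.fderiv_field hx]

/-- Because τ is parallel, the Γ̂ terms cancel and only K(τ,·) survives. -/
theorem hasFDerivAt_image_field {x : Euc n} (hx : x ∈ Ω) :
    HasFDerivAt (fun y => fderiv ℝ F y (τ y)) ((fderiv ℝ F x).comp (difference ε F x (τ x)) +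
      (metric ε F x (τ x)).smulRight (-(ε • F x))) x := by
  refine ((S.hasFDerivAt_fderiv hx).clm_apply (S.hasFDerivAt_field hx)).congr_fderiv ?_
  ext1 u
  simp [gauss_formula (S.frame x hx), inducedConnection_eq, S.difference_comm hx u,
    S.metric_comm hx u]
  abel

theorem contDiffOn_image_field : ContDiffOn ℝ ∞ (fun y => fderiv ℝ F y (τ y)) Ω :=
  fun _ hx => ((S.contDiffAt_fderiv hx).clm_apply
    (S.smooth_field.contDiffAt (S.isOpen.mem_nhds hx))).contDiffWithinAt

theorem fderiv_metric_field {x : Euc n} (hx : x ∈ Ω) :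
    HasFDerivAt (fun y => metric ε F y (τ y))
      ((ContinuousLinearMap.compL ℝ (Euc n) (Euc n) ℝ (metric ε F x (τ x))).comp
        (christoffel (metric ε F) x)) x := by
  refine ((S.hasFDerivAt_metric hx).clm_apply (S.hasFDerivAt_field hx)).congr_fderiv ?_
  ext u v
  simp [S.fderiv_metric hx]

theorem fderiv_difference_field {x : Euc n} (hx : x ∈ Ω) :
    HasFDerivAt (fun y => difference ε F y (τ y))
      ((ContinuousLinearMap.compL ℝ (Euc n) (Euc n) (Euc n) (difference ε F x (τ x))).comp
        (christoffel (metric ε F) x) -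
        ((ContinuousLinearMap.compL ℝ (Euc n) (Euc n) (Euc n)).flip
          (difference ε F x (τ x))).comp (christoffel (metric ε F) x)) x := by
  refine ((S.hasFDerivAt_difference hx).clm_apply (S.hasFDerivAt_field hx)).congr_fderiv ?_
  ext1 u
  ext1 v
  simp [S.fderiv_difference hx (S.parallel x hx _ _ _)]
  abel

theorem fderiv_fderiv_image_field {x : Euc n} (hx : x ∈ Ω) (u v : Euc n) :
    fderiv ℝ (fderiv ℝ (fun y => fderiv ℝ F y (τ y))) x u v =
      fderiv ℝ F x (difference ε F x u (difference ε F x (τ x) v)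
        + difference ε F x (τ x) (christoffel (metric ε F) x u v)
        - (ε * metric ε F x (τ x) v) • u)
      + (metric ε F x u (difference ε F x (τ x) v)
        + metric ε F x (τ x) (christoffel (metric ε F) x u v)) • -(ε • F x) := by
  set φ := fun y => fderiv ℝ F y (τ y) with hφ
  have h0 : HasFDerivAt (fderiv ℝ φ) (fderiv ℝ (fderiv ℝ φ) x) x :=
    (((S.contDiffOn_image_field.contDiffAt (S.isOpen.mem_nhds hx)).fderiv_right
      (m := ∞) (by simp)).differentiableAt (by simp)).hasFDerivAt
  have h1 := h0.clm_apply (hasFDerivAt_const v x)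
  have h2 := ((S.hasFDerivAt_fderiv hx).clm_apply ((S.fderiv_difference_field hx).clm_apply
    (hasFDerivAt_const v x))).add (((S.fderiv_metric_field hx).clm_apply
      (hasFDerivAt_const v x)).smul ((S.hasFDerivAt_self hx).const_smul ε).neg)
  have h3 := h2.congr_of_eventuallyEq (f₁ := fun y => fderiv ℝ φ y v)
    (Filter.eventually_of_mem (S.isOpen.mem_nhds hx) fun y hy => by
      have : fderiv ℝ φ y = _ := (S.hasFDerivAt_image_field hy).fderiv
      simp [this])
  have h4 := congrArg (fun L => L u) (h1.unique h3)
  simp at h4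
  rw [h4, gauss_formula (S.frame x hx), inducedConnection_eq]
  simp only [map_add, map_sub, map_smul]
  module

/-- The curvature identity `R̂(u, v) τ = 0`. -/
theorem curvature_identity {x : Euc n} (hx : x ∈ Ω) (u v : Euc n) :
    difference ε F x u (difference ε F x (τ x) v) - (ε * metric ε F x (τ x) v) • u =
      difference ε F x v (difference ε F x (τ x) u) - (ε * metric ε F x (τ x) u) • v := by
  -- The second derivative of dF(τ) is symmetric; its tangential part is the Gauss equation with
  -- R̂(u,v)τ = 0.
  have h := ((S.contDiffOn_image_field.contDiffAt (S.isOpen.mem_nhds hx)).isSymmSndFDerivAt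
    minSmoothness_two_le_infty).eq u v
  rw [S.fderiv_fderiv_image_field hx, S.fderiv_fderiv_image_field hx] at h
  have h1 := (S.frame_injective hx h).1
  rw [S.christoffel_comm hx v u] at h1
  linear_combination (norm := module) h1

theorem exists_ne_zero {x : Euc n} (hx : x ∈ Ω) : ∃ v ∈ D₂ x, v ≠ 0 := by
  refine (Submodule.ne_bot_iff _).1 fun h => ?_
  have := S.finrank₂ x hx
  rw [h, finrank_bot] at this
  have := S.pos₁
  omega

/-- This is R̂(v,τ)τ = 0 for v ≠ 0 in D₂. By `swap`, λ₃ is a root of the same quadratic, and the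
next two lemmas are Vieta's formulas. -/
theorem sq_eq {x : Euc n} (hx : x ∈ Ω) : l₂ ^ 2 = l₁ * l₂ - ε := by
  obtain ⟨v, hv, hv0⟩ := S.exists_ne_zero hx
  have h := S.curvature_identity hx v (τ x)
  rw [S.eigen₁ x hx, S.unit x hx, S.eigen₂ x hx v hv, S.orth₂ x hx v hv] at h
  simp only [map_smul, S.difference_comm hx v (τ x), S.eigen₂ x hx v hv] at h
  have h' : (l₂ ^ 2 - (l₁ * l₂ - ε)) • v = 0 := by
    linear_combination (norm := module) -h
  exact sub_eq_zero.1 ((smul_eq_zero.1 h').resolve_right hv0)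

theorem eigenvalue_sum {x : Euc n} (hx : x ∈ Ω) : l₁ = l₂ + l₃ := by
  have h1 := S.sq_eq hx
  have h2 := S.swap.sq_eq hx
  have h3 : (l₂ - l₃) * (l₁ - (l₂ + l₃)) = 0 := by linear_combination h2 - h1
  exact sub_eq_zero.1 ((mul_eq_zero.1 h3).resolve_left (sub_ne_zero.2 S.ne₂₃))

theorem eigenvalue_prod {x : Euc n} (hx : x ∈ Ω) : l₂ * l₃ = ε := by
  have h1 := S.sq_eq hx
  rw [S.eigenvalue_sum hx] at h1
  linarith

/-- R̂(v,w)τ = 0 reads λ₃K(v,w) = λ₂K(v,w). -/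
theorem difference_mixed {x : Euc n} (hx : x ∈ Ω) {v w : Euc n} (hv : v ∈ D₂ x)
    (hw : w ∈ D₃ x) : difference ε F x v w = 0 := by
  have h := S.curvature_identity hx v w
  rw [S.eigen₂ x hx v hv, S.eigen₃ x hx w hw, S.orth₂ x hx v hv, S.orth₃ x hx w hw] at h
  simp only [map_smul, S.difference_comm hx w v] at h
  have h' : (l₃ - l₂) • difference ε F x v w = 0 := by
    linear_combination (norm := module) h
  exact (smul_eq_zero.1 h').resolve_left (sub_ne_zero.2 S.ne₂₃.symm)

/-- By Codazzi h(·,K(·,·)) is totally symmetric: the τ-component is h(v,K(τ,v')) = λ₂h(v,v'), and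
the component along w in D₃ is h(v,K(w,v')) = 0. -/
theorem difference_same {x : Euc n} (hx : x ∈ Ω) (v : Euc n) {v' : Euc n}
    (hv' : v' ∈ D₂ x) :
    ∃ z ∈ D₂ x, difference ε F x v v' = (l₂ * metric ε F x v v') • τ x + z := by
  obtain ⟨z, hz, w, hw, h⟩ := S.exists_decomposition hx (difference ε F x v v')
  have h1 : metric ε F x (τ x) (difference ε F x v v') = l₂ * metric ε F x v v' := by
    rw [S.metric_difference_comm hx, S.eigen₂ x hx v' hv', map_smul, smul_eq_mul]
  have h2 : metric ε F x w (difference ε F x v v') = 0 := by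
    rw [S.metric_difference_comm hx, S.difference_comm hx, S.difference_mixed hx hv' hw, map_zero]
  have h3 : w = 0 := by
    refine S.eq_zero_of_metric_self hx ?_
    rw [h, map_add, map_add, map_smul, S.metric_comm hx w (τ x), S.orth₃ x hx w hw,
      S.metric_comm hx w z, S.orth₂₃ x hx z hz w hw] at h2
    simpa using h2
  exact ⟨z, hz, by rw [h1, h3, add_zero] at h; exact h⟩

/-- The tangential half of the Gauss formula for dF(τ). It is checked on τ, D₂ and D₃ components;
for two vectors of D₂ the coefficient of τ balances because λ₁λ₂ − ε = λ₂². -/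
theorem difference_commutation {x : Euc n} (hx : x ∈ Ω) (u v : Euc n) :
    difference ε F x u (difference ε F x (τ x) v) - (ε * metric ε F x (τ x) v) • u =
      difference ε F x (τ x) (difference ε F x u v) - (ε * metric ε F x u v) • τ x := by
  have hsum := S.eigenvalue_sum hx
  have hprod := S.eigenvalue_prod hx
  subst hsum
  subst hprod
  obtain ⟨v₂, hv₂, v₃, hv₃, hv⟩ := S.exists_decomposition hx v
  obtain ⟨u₂, hu₂, u₃, hu₃, hu⟩ := S.exists_decomposition hx u
  set b := metric (l₂ * l₃) F x (τ x) v
  set a := metric (l₂ * l₃) F x (τ x) u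
  obtain ⟨z₂, hz₂, e₂⟩ := S.difference_same hx u₂ hv₂
  obtain ⟨z₃, hz₃, e₃⟩ := S.swap.difference_same hx u₃ hv₃
  rw [hv, hu]
  simp only [map_add, map_smul, map_zero, add_apply, smul_apply,
    S.eigen₁ x hx, S.eigen₂ x hx _ hv₂, S.eigen₃ x hx _ hv₃, S.eigen₂ x hx _ hu₂,
    S.eigen₃ x hx _ hu₃, S.difference_comm hx _ (τ x), S.difference_mixed hx hu₂ hv₃,
    S.swap.difference_mixed hx hu₃ hv₂, e₂, e₃, S.eigen₂ x hx _ hz₂, S.eigen₃ x hx _ hz₃,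
    S.metric_comm hx u₂ (τ x), S.metric_comm hx u₃ (τ x), S.orth₂ x hx _ hv₂, S.orth₃ x hx _ hv₃,
    S.orth₂ x hx _ hu₂, S.orth₃ x hx _ hu₃, S.orth₂₃ x hx _ hu₂ _ hv₃, S.unit x hx,
    S.metric_comm hx u₃ v₂, S.orth₂₃ x hx _ hv₂ _ hu₃, smul_eq_mul]
  module

/-- By `exists_eq_clm` it suffices that dF(τ) satisfies the Gauss formula of F: the tangential part
is `difference_commutation`, the part along −εF is Codazzi. -/
theorem exists_endomorphism (hΩ : Convex ℝ Ω) :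
    ∃ B : Euc (n + 1) →L[ℝ] Euc (n + 1), ∀ x ∈ Ω, fderiv ℝ F x (τ x) = B (F x) := by
  refine S.exists_eq_clm S.sign_ne_zero hΩ S.contDiffOn_image_field fun x hx u v => ?_
  rw [S.fderiv_fderiv_image_field hx, (S.hasFDerivAt_image_field hx).fderiv, inducedConnection_eq]
  have h1 := S.difference_commutation hx u v
  have h2 := S.metric_difference_comm hx u (τ x) v
  have h3 : difference ε F x u (difference ε F x (τ x) v)
        + difference ε F x (τ x) (christoffel (metric ε F) x u v)
        - (ε * metric ε F x (τ x) v) • u = difference ε F x (τ x) (christoffel (metric ε F) x u v) +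
      difference ε F x (τ x) (difference ε F x u v) - (ε * metric ε F x u v) • τ x := by
    linear_combination (norm := module) h1
  rw [h3, h2]
  simp
  module

end EigenSplitting

end Splitting
end Centroaffine

/-! ### Eigenspaces of B, the parallel projection onto D₂, and the components of F. -/

namespace Centroaffine
noncomputable section Slices

set_option maxSynthPendingDepth 5

variable {n : ℕ}

/-- An endomorphism with two large eigenspaces is diagonal for a product decomposition. -/
theorem exists_eigen_splitting {N n₁ n₂ : ℕ} (hN : N + 1 = (n₁ + 1) + (n₂ + 1))
    (B : Euc (N + 1) →L[ℝ] Euc (N + 1)) {l₂ l₃ : ℝ} (hl : l₂ ≠ l₃)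
    (h₂ : n₁ + 1 ≤ Module.finrank ℝ (Module.End.eigenspace (B : Module.End ℝ (Euc (N + 1))) l₂))
    (h₃ : n₂ + 1 ≤ Module.finrank ℝ (Module.End.eigenspace (B : Module.End ℝ (Euc (N + 1))) l₃)) :
    ∃ A : Euc (N + 1) ≃L[ℝ] Euc (n₁ + 1) × Euc (n₂ + 1),
      ∀ z, (A (B z)).1 = l₂ • (A z).1 ∧ (A (B z)).2 = l₃ • (A z).2 := by
  set E₂ := Module.End.eigenspace (B : Module.End ℝ (Euc (N + 1))) l₂
  set E₃ := Module.End.eigenspace (B : Module.End ℝ (Euc (N + 1))) l₃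
  have hdisj : Disjoint E₂ E₃ :=
    Module.End.eigenspaces_iSupIndep (B : Module.End ℝ (Euc (N + 1))) |>.pairwiseDisjoint hl
  have hsum := Submodule.finrank_sup_add_finrank_inf_eq E₂ E₃
  rw [hdisj.eq_bot, finrank_bot, add_zero] at hsum
  have hle : Module.finrank ℝ ↥(E₂ ⊔ E₃) ≤ N + 1 := by
    simpa using Submodule.finrank_le (E₂ ⊔ E₃)
  have hcompl : IsCompl E₂ E₃ := by
    refine ⟨hdisj, codisjoint_iff.2 (Submodule.eq_top_of_finrank_eq ?_)⟩
    rw [finrank_euclideanSpace_fin]; omega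
  have e₂ : E₂ ≃ₗ[ℝ] Euc (n₁ + 1) := LinearEquiv.ofFinrankEq _ _ (by
    rw [finrank_euclideanSpace_fin]; omega)
  have e₃ : E₃ ≃ₗ[ℝ] Euc (n₂ + 1) := LinearEquiv.ofFinrankEq _ _ (by
    rw [finrank_euclideanSpace_fin]; omega)
  let A := (Submodule.prodEquivOfIsCompl E₂ E₃ hcompl).symm.trans (e₂.prodCongr e₃)
  have hA : ∀ (a : E₂) (b : E₃), A ((a : Euc (N + 1)) + b) = (e₂ a, e₃ b) := fun a b => by
    have : ((a : Euc (N + 1)) + b) = Submodule.prodEquivOfIsCompl E₂ E₃ hcompl (a, b) := by simp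
    simp only [A, LinearEquiv.trans_apply]
    rw [this, LinearEquiv.symm_apply_apply]
    rfl
  refine ⟨A.toContinuousLinearEquiv, fun z => ?_⟩
  obtain ⟨⟨a, b⟩, rfl⟩ := (Submodule.prodEquivOfIsCompl E₂ E₃ hcompl).surjective z
  have ha : B a = ((l₂ • a : E₂) : Euc (N + 1)) := Module.End.mem_eigenspace_iff.1 a.2
  have hb : B b = ((l₃ • b : E₃) : Euc (N + 1)) := Module.End.mem_eigenspace_iff.1 b.2
  simp only [Submodule.coe_prodEquivOfIsCompl', map_add B, ha, hb,
    LinearEquiv.coe_toContinuousLinearEquiv', hA, map_smul, and_self]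

namespace EigenSplitting

variable {ε : ℝ} {F : Euc n → Euc (n + 1)} {Ω : Set (Euc n)} {τ : Euc n → Euc n}
  {D₂ D₃ : Euc n → Submodule ℝ (Euc n)} {n₁ n₂ : ℕ} {l₁ l₂ l₃ : ℝ}
  (S : EigenSplitting ε F Ω τ D₂ D₃ n₁ n₂ l₁ l₂ l₃)
include S

theorem endomorphism_fderiv {B : Euc (n + 1) →L[ℝ] Euc (n + 1)}
    (hB : ∀ x ∈ Ω, fderiv ℝ F x (τ x) = B (F x)) {x : Euc n} (hx : x ∈ Ω) (v : Euc n) :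
    B (fderiv ℝ F x v) =
      fderiv ℝ F x (difference ε F x (τ x) v) + metric ε F x (τ x) v • -(ε • F x) := by
  have h1 := (hasFDerivAt_const B x).clm_apply (S.hasFDerivAt_self hx)
  have h2 := h1.congr_of_eventuallyEq (f₁ := fun y => fderiv ℝ F y (τ y))
    (Filter.eventually_of_mem (S.isOpen.mem_nhds hx) fun y hy => hB y hy)
  have h3 := congrArg (fun L => L v) (h2.unique (S.hasFDerivAt_image_field hx))
  simpa using h3

theorem endomorphism_fderiv₂ {B : Euc (n + 1) →L[ℝ] Euc (n + 1)}
    (hB : ∀ x ∈ Ω, fderiv ℝ F x (τ x) = B (F x)) {x : Euc n} (hx : x ∈ Ω) {v : Euc n}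
    (hv : v ∈ D₂ x) : B (fderiv ℝ F x v) = l₂ • fderiv ℝ F x v := by
  rw [S.endomorphism_fderiv hB hx, S.eigen₂ x hx v hv, S.orth₂ x hx v hv]
  simp

/-- Equivalently (B − λ₂)(B − λ₃)F = 0, so BF − λ₃F lies in the λ₂-eigenspace. -/
theorem endomorphism_sq {B : Euc (n + 1) →L[ℝ] Euc (n + 1)}
    (hB : ∀ x ∈ Ω, fderiv ℝ F x (τ x) = B (F x)) {x : Euc n} (hx : x ∈ Ω) :
    B (B (F x)) = (l₂ + l₃) • B (F x) - (l₂ * l₃) • F x := by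
  rw [← hB x hx, S.endomorphism_fderiv hB hx, S.eigen₁ x hx, S.unit x hx, S.eigenvalue_prod hx,
    ← S.eigenvalue_sum hx, map_smul]
  module

theorem frame_independent {B : Euc (n + 1) →L[ℝ] Euc (n + 1)}
    (hB : ∀ x ∈ Ω, fderiv ℝ F x (τ x) = B (F x)) {x : Euc n} (hx : x ∈ Ω) {v : Euc n}
    (hv : v ∈ D₂ x) {c : ℝ} (h : c • (B (F x) - l₃ • F x) + fderiv ℝ F x v = 0) :
    c = 0 ∧ v = 0 := by
  have hε := S.sign_ne_zero
  have h1 : fderiv ℝ F x (c • τ x + v + 0) + (c * l₃ / ε) • -(ε • F x) =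
      fderiv ℝ F x 0 + (0 : ℝ) • -(ε • F x) := by
    have e : (c * l₃ / ε) • -(ε • F x) = -((c * l₃) • F x) := by
      rw [smul_neg, smul_smul, div_mul_cancel₀ _ hε]
    rw [e, add_zero, map_add, map_smul, hB x hx, map_zero, zero_smul, add_zero, ← h]
    module
  obtain ⟨h2, h3, -⟩ := S.components_eq_zero hx hv (zero_mem _) (S.frame_injective hx h1).1
  exact ⟨h2, h3⟩

/-- dF(D₂) supplies n₁ independent eigenvectors, and BF − λ₃F the remaining one. -/
theorem finrank_eigenspace {B : Euc (n + 1) →L[ℝ] Euc (n + 1)}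
    (hB : ∀ x ∈ Ω, fderiv ℝ F x (τ x) = B (F x)) {x : Euc n} (hx : x ∈ Ω) :
    n₁ + 1 ≤ Module.finrank ℝ (Module.End.eigenspace (B : Module.End ℝ (Euc (n + 1))) l₂) := by
  let f : (ℝ × D₂ x) →ₗ[ℝ] Euc (n + 1) :=
    (LinearMap.toSpanSingleton ℝ (Euc (n + 1)) (B (F x) - l₃ • F x)).coprod
      ((fderiv ℝ F x : Euc n →ₗ[ℝ] Euc (n + 1)).comp (D₂ x).subtype)
  have hf : ∀ c v, f (c, v) = c • (B (F x) - l₃ • F x) + fderiv ℝ F x v := fun c v => by simp [f]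
  have hmem : ∀ p, f p ∈ Module.End.eigenspace (B : Module.End ℝ (Euc (n + 1))) l₂ := by
    rintro ⟨c, v⟩
    rw [Module.End.mem_eigenspace_iff, hf]
    simp only [ContinuousLinearMap.coe_coe, map_add, map_smul, map_sub,
      S.endomorphism_fderiv₂ hB hx v.2, S.endomorphism_sq hB hx]
    module
  have hinj : Function.Injective (f.codRestrict _ hmem) := by
    refine (injective_iff_map_eq_zero _).2 ?_
    rintro ⟨c, v⟩ h
    have h' : f (c, v) = 0 := congrArg Subtype.val h
    rw [hf] at h'
    obtain ⟨h1, h2⟩ := S.frame_independent hB hx v.2 h'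
    simp [h1, Subtype.ext_iff, h2]
  have := LinearMap.finrank_le_finrank_of_injective hinj
  rw [Module.finrank_prod, Module.finrank_self, S.finrank₂ x hx] at this
  omega

/-- The projection onto `D₂` along `τ` and `D₃`. -/
def proj (_ : EigenSplitting ε F Ω τ D₂ D₃ n₁ n₂ l₁ l₂ l₃) (x : Euc n) : Euc n →L[ℝ] Euc n :=
  (l₂ - l₃)⁻¹ • (difference ε F x (τ x) - l₃ • ContinuousLinearMap.id ℝ (Euc n)
    - l₂ • (metric ε F x (τ x)).smulRight (τ x))

theorem proj_apply (x v : Euc n) : S.proj x v = (l₂ - l₃)⁻¹ • (difference ε F x (τ x) v - l₃ • v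
    - (l₂ * metric ε F x (τ x) v) • τ x) := by
  simp [proj, mul_smul]

/-- K(τ,·) − λ₃ acts by λ₁ − λ₃ = λ₂ on τ, by λ₂ − λ₃ on D₂ and by 0 on D₃; the rank-one term in
`proj` removes the action on τ. -/
theorem proj_eq {x : Euc n} (hx : x ∈ Ω) {v w : Euc n} (c : ℝ) (hv : v ∈ D₂ x) (hw : w ∈ D₃ x) :
    S.proj x (c • τ x + v + w) = v := by
  have hl : l₂ - l₃ ≠ 0 := sub_ne_zero.2 S.ne₂₃
  rw [proj_apply, inv_smul_eq_iff₀ hl]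
  simp only [map_add, map_smul, S.eigen₁ x hx, S.eigen₂ x hx v hv, S.eigen₃ x hx w hw,
    S.unit x hx, S.orth₂ x hx v hv, S.orth₃ x hx w hw, S.eigenvalue_sum hx, smul_eq_mul]
  module

theorem proj_of_mem {x : Euc n} (hx : x ∈ Ω) {v : Euc n} (hv : v ∈ D₂ x) : S.proj x v = v := by
  simpa using S.proj_eq hx 0 hv (zero_mem (D₃ x))

theorem proj_mem {x : Euc n} (hx : x ∈ Ω) (v : Euc n) : S.proj x v ∈ D₂ x := by
  obtain ⟨a, ha, b, hb, h⟩ := S.exists_decomposition hx v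
  rw [h, S.proj_eq hx _ ha hb]
  exact ha

theorem metric_proj {x : Euc n} (hx : x ∈ Ω) (v : Euc n) {w : Euc n} (hw : w ∈ D₂ x) :
    metric ε F x (S.proj x v) w = metric ε F x v w := by
  obtain ⟨a, ha, b, hb, h⟩ := S.exists_decomposition hx v
  generalize metric ε F x (τ x) v = c at h
  rw [h, S.proj_eq hx _ ha hb]
  simp [S.orth₂ x hx w hw, S.metric_comm hx b, S.orth₂₃ x hx w hw b hb]

theorem eq_add_proj {x : Euc n} (hx : x ∈ Ω) (v : Euc n) :
    v = metric ε F x (τ x) v • τ x + S.proj x v + S.swap.proj x v := by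
  obtain ⟨a, ha, b, hb, h⟩ := S.exists_decomposition hx v
  generalize metric ε F x (τ x) v = c at h
  subst h
  have h' := S.swap.proj_eq hx c hb ha
  rw [add_right_comm] at h'
  rw [S.proj_eq hx _ ha hb, h']

/-- The projection is built from the parallel tensors h, K and τ, hence is parallel itself. The
distributions carry no smoothness assumption; their regularity enters through this formula. -/
theorem fderiv_proj {x : Euc n} (hx : x ∈ Ω) :
    ∃ P' : Euc n →L[ℝ] Euc n →L[ℝ] Euc n, HasFDerivAt S.proj P' x ∧ ∀ u v,
      P' u v = S.proj x (christoffel (metric ε F) x u v)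
        - christoffel (metric ε F) x u (S.proj x v) := by
  have h0 : ContDiffAt ℝ ∞ τ x := S.smooth_field.contDiffAt (S.isOpen.mem_nhds hx)
  have h1 : HasFDerivAt S.proj (fderiv ℝ S.proj x) x := by
    refine DifferentiableAt.hasFDerivAt (ContDiffAt.differentiableAt (n := ∞) ?_ (by simp))
    exact ((((S.contDiffAt_difference hx).clm_apply h0).sub contDiffAt_const).sub
      ((((S.contDiffAt_metric hx).clm_apply h0).smulRight h0).const_smul l₂)).const_smul _
  refine ⟨_, h1, fun u v => ?_⟩
  have h2 := h1.clm_apply (hasFDerivAt_const v x)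
  have h3 := ((((S.fderiv_difference_field hx).clm_apply (hasFDerivAt_const v x)).sub
    (hasFDerivAt_const (l₃ • v) x)).sub ((((S.fderiv_metric_field hx).clm_apply
      (hasFDerivAt_const v x)).const_smul l₂).smul (S.hasFDerivAt_field hx))).const_smul
        ((l₂ - l₃)⁻¹)
  have h4 := h3.congr_of_eventuallyEq (f₁ := fun y => S.proj y v)
    (Filter.Eventually.of_forall fun y => by simp [S.proj_apply, mul_smul])
  have h5 := congrArg (fun L => L u) (h2.unique h4)
  simp at h5
  rw [h5, S.proj_apply, S.proj_apply]
  simp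
  module

end EigenSplitting

/-- `A` restricts to an isomorphism from the `l`-eigenspace of `B`, and kills its complement. -/
structure IsEigenProjection {N m : ℕ} (B : Euc (N + 1) →L[ℝ] Euc (N + 1)) (l : ℝ)
    (A : Euc (N + 1) →L[ℝ] Euc (m + 1)) : Prop where
  map : ∀ z, A (B z) = l • A z
  injective : ∀ z, B z = l • z → A z = 0 → z = 0

theorem IsEigenProjection.smul {N m : ℕ} {B : Euc (N + 1) →L[ℝ] Euc (N + 1)} {l : ℝ}
    {A : Euc (N + 1) →L[ℝ] Euc (m + 1)} (h : IsEigenProjection B l A) {c : ℝ} (hc : c ≠ 0) :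
    IsEigenProjection B l (c • A) where
  map := fun z => by simp [h.map, smul_comm c l]
  injective := fun z hz hA => h.injective z hz ((smul_eq_zero.1 hA).resolve_left hc)

namespace EigenSplitting

variable {ε : ℝ} {F : Euc n → Euc (n + 1)} {Ω : Set (Euc n)} {τ : Euc n → Euc n}
  {D₂ D₃ : Euc n → Submodule ℝ (Euc n)} {n₁ n₂ m : ℕ} {l₁ l₂ l₃ : ℝ}
  (S : EigenSplitting ε F Ω τ D₂ D₃ n₁ n₂ l₁ l₂ l₃) {B : Euc (n + 1) →L[ℝ] Euc (n + 1)}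
  (hB : ∀ x ∈ Ω, fderiv ℝ F x (τ x) = B (F x)) {A : Euc (n + 1) →L[ℝ] Euc (m + 1)}
  (hA : IsEigenProjection B l₂ A)
include S hB hA

/-- A kills dF(D₃), which consists of λ₃-eigenvectors, and sends dF(τ) = BF to λ₂AF. -/
theorem projection_fderiv {x : Euc n} (hx : x ∈ Ω) (v : Euc n) :
    A (fderiv ℝ F x v) =
      A (fderiv ℝ F x (S.proj x v)) + (l₂ * metric ε F x (τ x) v) • A (F x) := by
  have hv := S.eq_add_proj hx v
  have h1 := hA.map (fderiv ℝ F x (S.swap.proj x v))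
  rw [S.swap.endomorphism_fderiv₂ hB hx (S.swap.proj_mem hx v), map_smul, ← sub_eq_zero,
    ← sub_smul] at h1
  have h2 := (smul_eq_zero.1 h1).resolve_left (sub_ne_zero.2 S.ne₂₃.symm)
  conv_lhs => rw [hv]
  rw [map_add, map_add, map_add, map_add, h2, map_smul, map_smul, hB x hx, hA.map]
  module

/-- A is injective on the λ₂-eigenspace, which contains dF(v) and BF − λ₃F, and A maps the latter to
(λ₂ − λ₃)AF. -/
theorem projection_independent {x : Euc n} (hx : x ∈ Ω) {v : Euc n} (hv : v ∈ D₂ x) {c : ℝ}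
    (h : A (fderiv ℝ F x v) + c • A (F x) = 0) : v = 0 ∧ c = 0 := by
  have hl : l₂ - l₃ ≠ 0 := sub_ne_zero.2 S.ne₂₃
  have h1 : c • (B (F x) - l₃ • F x) + fderiv ℝ F x ((l₂ - l₃) • v) = 0 := by
    refine hA.injective _ ?_ ?_
    · rw [map_smul (fderiv ℝ F x), map_add, map_smul, map_smul, map_sub, map_smul,
        S.endomorphism_fderiv₂ hB hx hv, S.endomorphism_sq hB hx]
      module
    · rw [map_smul (fderiv ℝ F x), map_add, map_smul, map_smul, map_sub, map_smul, hA.map,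
        ← smul_zero (l₂ - l₃), ← h]
      module
  obtain ⟨h2, h3⟩ := S.frame_independent hB hx ((D₂ x).smul_mem _ hv) h1
  exact ⟨(smul_eq_zero.1 h3).resolve_left hl, h2⟩

end EigenSplitting

end Slices
end Centroaffine

/-! ### Leaves of D₂ and their images as centroaffine hypersurfaces with parallel cubic form. -/

namespace Centroaffine
noncomputable section Leaves

set_option maxSynthPendingDepth 5

variable {n : ℕ}

/-- Since ∇̂h = 0, only two K terms remain, and Codazzi makes them equal. -/
theorem ConvexParam.cubicForm_eq {ε : ℝ} {F : Euc n → Euc (n + 1)} {Ω : Set (Euc n)}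
    (H : ConvexParam ε F Ω) {x : Euc n} (hx : x ∈ Ω) (u v w : Euc n) :
    cubicForm ε F x u v w = -2 * metric ε F x (difference ε F x u v) w := by
  have h1 := ((H.hasFDerivAt_metric hx).clm_apply (hasFDerivAt_const v x)).clm_apply
    (hasFDerivAt_const w x)
  have h2 : metric ε F x v (difference ε F x u w) = metric ε F x (difference ε F x u v) w := by
    rw [H.difference_comm hx u w, H.metric_difference_comm hx, H.metric_comm hx,
      H.difference_comm hx v u]
  rw [cubicForm, h1.fderiv]
  simp [H.fderiv_metric hx, inducedConnection_eq, h2]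
  ring

/-- `j` parametrizes an integral manifold of `D₂` of full dimension. -/
structure EigenSplitting.IsLeaf {ε : ℝ} {F : Euc n → Euc (n + 1)} {Ω : Set (Euc n)}
    {τ : Euc n → Euc n} {D₂ D₃ : Euc n → Submodule ℝ (Euc n)} {n₁ n₂ : ℕ} {l₁ l₂ l₃ : ℝ}
    (_ : EigenSplitting ε F Ω τ D₂ D₃ n₁ n₂ l₁ l₂ l₃) (j : Euc n₁ → Euc n) (U : Set (Euc n₁)) :
    Prop where
  isOpen : IsOpen U
  smooth : ContDiffOn ℝ ∞ j U
  mapsTo : Set.MapsTo j U Ω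
  tangent : ∀ p ∈ U, ∀ v, fderiv ℝ j p v ∈ D₂ (j p)
  injective : ∀ p ∈ U, ∀ v, fderiv ℝ j p v = 0 → v = 0

namespace EigenSplitting.IsLeaf

variable {ε : ℝ} {F : Euc n → Euc (n + 1)} {Ω : Set (Euc n)} {τ : Euc n → Euc n}
  {D₂ D₃ : Euc n → Submodule ℝ (Euc n)} {n₁ n₂ : ℕ} {l₁ l₂ l₃ : ℝ}
  {S : EigenSplitting ε F Ω τ D₂ D₃ n₁ n₂ l₁ l₂ l₃}
  {j : Euc n₁ → Euc n} {U : Set (Euc n₁)} (J : S.IsLeaf j U)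
include J

theorem contDiffAt {p : Euc n₁} (hp : p ∈ U) : ContDiffAt ℝ ∞ j p :=
  J.smooth.contDiffAt (J.isOpen.mem_nhds hp)

theorem hasFDerivAt {p : Euc n₁} (hp : p ∈ U) : HasFDerivAt j (fderiv ℝ j p) p :=
  ((J.contDiffAt hp).differentiableAt (by simp)).hasFDerivAt

theorem hasFDerivAt_fderiv {p : Euc n₁} (hp : p ∈ U) :
    HasFDerivAt (fderiv ℝ j) (fderiv ℝ (fderiv ℝ j) p) p :=
  (((J.contDiffAt hp).fderiv_right (m := ∞) (by simp)).differentiableAt (by simp)).hasFDerivAt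

theorem fderiv_fderiv_comm {p : Euc n₁} (hp : p ∈ U) (u v : Euc n₁) :
    fderiv ℝ (fderiv ℝ j) p u v = fderiv ℝ (fderiv ℝ j) p v u :=
  ((J.contDiffAt hp).isSymmSndFDerivAt minSmoothness_two_le_infty).eq u v

theorem exists_fderiv_eq {p : Euc n₁} (hp : p ∈ U) {X : Euc n} (hX : X ∈ D₂ (j p)) :
    ∃ v, fderiv ℝ j p v = X := by
  let f : Euc n₁ →ₗ[ℝ] D₂ (j p) :=
    (fderiv ℝ j p : Euc n₁ →ₗ[ℝ] Euc n).codRestrict (D₂ (j p)) (J.tangent p hp)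
  have hinj : Function.Injective f := (injective_iff_map_eq_zero f).2 fun v hv =>
    J.injective p hp v (congrArg Subtype.val hv)
  have hsurj := (LinearMap.injective_iff_surjective_of_finrank_eq_finrank (by
    rw [S.finrank₂ _ (J.mapsTo hp), finrank_euclideanSpace_fin])).1 hinj
  obtain ⟨v, hv⟩ := hsurj ⟨X, hX⟩
  exact ⟨v, congrArg Subtype.val hv⟩

/-- The covariant derivative along a leaf is tangent to the leaf. -/
theorem christoffel_add_mem {p : Euc n₁} (hp : p ∈ U) (u v : Euc n₁) :
    christoffel (metric ε F) (j p) (fderiv ℝ j p u) (fderiv ℝ j p v)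
      + fderiv ℝ (fderiv ℝ j) p u v ∈ D₂ (j p) := by
  have hy := J.mapsTo hp
  obtain ⟨P', hP', hP⟩ := S.fderiv_proj hy
  have h1 := (hP'.comp p (J.hasFDerivAt hp)).clm_apply
    ((J.hasFDerivAt_fderiv hp).clm_apply (hasFDerivAt_const v p))
  -- The identity dj(v) = P dj(v), P the projection, is differentiated; as P is parallel, the
  -- covariant derivative of dj(v) is fixed by P as well.
  have h2 := h1.congr_of_eventuallyEq (f₁ := fun q => fderiv ℝ j q v)
    (Filter.eventually_of_mem (J.isOpen.mem_nhds hp) fun q hq =>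
      (S.proj_of_mem (J.mapsTo hq) (J.tangent q hq v)).symm)
  have h3 := congrArg (fun L => L u)
    (((J.hasFDerivAt_fderiv hp).clm_apply (hasFDerivAt_const v p)).unique h2)
  simp [hP, S.proj_of_mem hy (J.tangent p hp v)] at h3
  have h4 : christoffel (metric ε F) (j p) (fderiv ℝ j p u) (fderiv ℝ j p v)
      + fderiv ℝ (fderiv ℝ j) p u v =
      S.proj (j p) (christoffel (metric ε F) (j p) (fderiv ℝ j p u) (fderiv ℝ j p v)
      + fderiv ℝ (fderiv ℝ j) p u v) := by
    rw [map_add]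
    linear_combination (norm := module) h3
  rw [h4]
  exact S.proj_mem hy _

section Image

variable {B : Euc (n + 1) →L[ℝ] Euc (n + 1)} {A : Euc (n + 1) →L[ℝ] Euc (n₁ + 1)}
  {G : Euc n₁ → Euc (n₁ + 1)} {c ε₁ : ℝ}

theorem fderiv_image (hG : ∀ p ∈ U, G p = A (F (j p))) {p : Euc n₁} (hp : p ∈ U) (v : Euc n₁) :
    fderiv ℝ G p v = A (fderiv ℝ F (j p) (fderiv ℝ j p v)) := by
  have h1 : HasFDerivAt (fun q => A (F (j q))) (A.comp ((fderiv ℝ F (j p)).comp (fderiv ℝ j p))) p :=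
    A.hasFDerivAt.comp p ((S.hasFDerivAt_self (J.mapsTo hp)).comp p (J.hasFDerivAt hp))
  have h2 := h1.congr_of_eventuallyEq (f₁ := G)
    (Filter.eventually_of_mem (J.isOpen.mem_nhds hp) hG)
  rw [h2.fderiv]
  simp

theorem contDiffOn_image (hG : ∀ p ∈ U, G p = A (F (j p))) : ContDiffOn ℝ ∞ G U :=
  (A.contDiff.comp_contDiffOn (S.smooth.comp J.smooth J.mapsTo)).congr hG

theorem fderiv_fderiv_image (hG : ∀ p ∈ U, G p = A (F (j p))) {p : Euc n₁} (hp : p ∈ U)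
    (u v : Euc n₁) : fderiv ℝ (fderiv ℝ G) p u v =
      A (fderiv ℝ (fderiv ℝ F) (j p) (fderiv ℝ j p u) (fderiv ℝ j p v)
        + fderiv ℝ F (j p) (fderiv ℝ (fderiv ℝ j) p u v)) := by
  have h0 : HasFDerivAt (fderiv ℝ G) (fderiv ℝ (fderiv ℝ G) p) p :=
    ((((J.contDiffOn_image hG).contDiffAt (J.isOpen.mem_nhds hp)).fderiv_right
      (m := ∞) (by simp)).differentiableAt (by simp)).hasFDerivAt
  have h1 := h0.clm_apply (hasFDerivAt_const v p)
  have h2 := A.hasFDerivAt.comp p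
    (((S.hasFDerivAt_fderiv (J.mapsTo hp)).comp p (J.hasFDerivAt hp)).clm_apply
    ((J.hasFDerivAt_fderiv hp).clm_apply (hasFDerivAt_const v p)))
  have h3 := h2.congr_of_eventuallyEq (f₁ := fun q => fderiv ℝ G q v)
    (Filter.eventually_of_mem (J.isOpen.mem_nhds hp) fun q hq => J.fderiv_image hG hq v)
  have h4 := congrArg (fun L => L u) (h1.unique h3)
  simp at h4
  rw [h4, map_add]
  exact add_comm _ _

variable (hB : ∀ x ∈ Ω, fderiv ℝ F x (τ x) = B (F x)) (hA : IsEigenProjection B l₂ A)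
  (hG : ∀ p ∈ U, G p = A (F (j p))) (hc : c * ε₁ = ε - l₂ ^ 2)
include hB hA hG

theorem isInvertible_frame (hε₁ : ε₁ ≠ 0) {p : Euc n₁} (hp : p ∈ U) :
    (gaussFrame ε₁ G p).IsInvertible := by
  refine isInvertible_gaussFrame fun v s h => ?_
  rw [J.fderiv_image hG hp, hG p hp, smul_neg, smul_smul, ← neg_smul] at h
  obtain ⟨h1, h2⟩ := S.projection_independent hB hA (J.mapsTo hp) (J.tangent p hp v) h
  exact ⟨J.injective p hp v h1, by simpa [hε₁] using h2⟩

include hc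

/-- A turns the τ-part λ₂h(u,v)τ of K into λ₂²h(u,v)AF. Added to −εh(u,v)AF this gives (λ₂² −
ε)h(u,v)AF, which is −cε₁h(u,v)AF; hence the choice of c and ε₁. -/
theorem metric_and_connection (hε₁ : ε₁ ≠ 0) {p : Euc n₁} (hp : p ∈ U) (u v : Euc n₁) :
    metric ε₁ G p u v = c * metric ε F (j p) (fderiv ℝ j p u) (fderiv ℝ j p v) ∧
    fderiv ℝ j p (inducedConnection ε₁ G p u v) =
      S.proj (j p) (difference ε F (j p) (fderiv ℝ j p u) (fderiv ℝ j p v))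
      + (christoffel (metric ε F) (j p) (fderiv ℝ j p u) (fderiv ℝ j p v)
      + fderiv ℝ (fderiv ℝ j) p u v) := by
  have hy := J.mapsTo hp
  have hZ := J.christoffel_add_mem hp u v
  set K := difference ε F (j p) (fderiv ℝ j p u) (fderiv ℝ j p v) with hKdef
  set Z := christoffel (metric ε F) (j p) (fderiv ℝ j p u) (fderiv ℝ j p v)
      + fderiv ℝ (fderiv ℝ j) p u v with hZdef
  obtain ⟨z, hz⟩ := J.exists_fderiv_eq hp ((D₂ (j p)).add_mem (S.proj_mem hy K) hZ)
  have hτ : metric ε F (j p) (τ (j p)) (K + Z) =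
      l₂ * metric ε F (j p) (fderiv ℝ j p u) (fderiv ℝ j p v) := by
    rw [map_add, S.orth₂ _ hy _ hZ, hKdef, S.metric_difference_comm hy,
      S.eigen₂ _ hy _ (J.tangent p hp v), map_smul, smul_eq_mul, add_zero]
  have key : fderiv ℝ (fderiv ℝ G) p u v = fderiv ℝ G p z +
      (c * metric ε F (j p) (fderiv ℝ j p u) (fderiv ℝ j p v)) • -(ε₁ • G p) := by
    have e : fderiv ℝ (fderiv ℝ F) (j p) (fderiv ℝ j p u) (fderiv ℝ j p v)
        + fderiv ℝ F (j p) (fderiv ℝ (fderiv ℝ j) p u v) = fderiv ℝ F (j p) (K + Z) +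
        metric ε F (j p) (fderiv ℝ j p u) (fderiv ℝ j p v) • -(ε • F (j p)) := by
      rw [gauss_formula (S.frame _ hy), inducedConnection_eq, hZdef]
      simp only [map_add]
      abel
    rw [J.fderiv_fderiv_image hG hp, J.fderiv_image hG hp, hz, e, map_add A,
      S.projection_fderiv hB hA hy, hτ, map_add (S.proj (j p)), S.proj_of_mem hy hZ, hG p hp]
    simp only [map_smul, map_neg]
    have e2 : (c * metric ε F (j p) (fderiv ℝ j p u) (fderiv ℝ j p v)) • -(ε₁ • A (F (j p))) =
        ((l₂ ^ 2 - ε) * metric ε F (j p) (fderiv ℝ j p u) (fderiv ℝ j p v)) • A (F (j p)) := by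
      rw [smul_neg, smul_smul, ← neg_smul]
      congr 1
      linear_combination -metric ε F (j p) (fderiv ℝ j p u) (fderiv ℝ j p v) * hc
    rw [e2]
    module
  obtain ⟨h1, h2⟩ := gauss_components (J.isInvertible_frame hB hA hG hε₁ hp) key
  exact ⟨h1, by rw [h2, hz]⟩

theorem convexParam (hε₁ : ε₁ ≠ 0) (hc0 : 0 < c) : ConvexParam ε₁ G U where
  isOpen := J.isOpen
  smooth := J.contDiffOn_image hG
  frame := fun _ hp => J.isInvertible_frame hB hA hG hε₁ hp
  pos := fun p hp v hv => by
    rw [(J.metric_and_connection hB hA hG hc hε₁ hp v v).1]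
    exact mul_pos hc0 (S.pos _ (J.mapsTo hp) _ fun h => hv (J.injective p hp v h))

/-- The induced metric is c times the restriction of h, and the leaf is totally geodesic, so its
Levi-Civita connection is the restriction of that of h; the two are compared by the Koszul formula.
-/
theorem fderiv_christoffel (hε₁ : ε₁ ≠ 0) (hc0 : 0 < c) {p : Euc n₁} (hp : p ∈ U)
    (u v : Euc n₁) : fderiv ℝ j p (christoffel (metric ε₁ G) p u v) =
      christoffel (metric ε F) (j p) (fderiv ℝ j p u) (fderiv ℝ j p v)
      + fderiv ℝ (fderiv ℝ j) p u v := by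
  have H := J.convexParam hB hA hG hc hε₁ hc0
  have hy := J.mapsTo hp
  have hm : ∀ u v w, fderiv ℝ (metric ε₁ G) p u v w = c *
      (metric ε F (j p) (christoffel (metric ε F) (j p) (fderiv ℝ j p u) (fderiv ℝ j p v)
        + fderiv ℝ (fderiv ℝ j) p u v) (fderiv ℝ j p w) +
      metric ε F (j p) (fderiv ℝ j p v) (christoffel (metric ε F) (j p) (fderiv ℝ j p u)
        (fderiv ℝ j p w) + fderiv ℝ (fderiv ℝ j) p u w)) := by
    intro u v w
    have h1 := ((H.hasFDerivAt_metric hp).clm_apply (hasFDerivAt_const v p)).clm_apply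
      (hasFDerivAt_const w p)
    have h2 := ((((S.hasFDerivAt_metric hy).comp p (J.hasFDerivAt hp)).clm_apply
      ((J.hasFDerivAt_fderiv hp).clm_apply (hasFDerivAt_const v p))).clm_apply
      ((J.hasFDerivAt_fderiv hp).clm_apply (hasFDerivAt_const w p))).const_smul c
    have h3 := h2.congr_of_eventuallyEq (f₁ := fun q => metric ε₁ G q v w)
      (Filter.eventually_of_mem (J.isOpen.mem_nhds hp) fun q hq =>
        (J.metric_and_connection hB hA hG hc hε₁ hq v w).1)
    have h4 := congrArg (fun L => L u) (h1.unique h3)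
    simp [S.fderiv_metric hy] at h4
    rw [h4]
    simp only [map_add, add_apply]
    ring
  obtain ⟨z, hz⟩ := J.exists_fderiv_eq hp (J.christoffel_add_mem hp u v)
  suffices h : christoffel (metric ε₁ G) p u v = z by rw [h, hz]
  refine H.eq_of_metric_eq hp fun w => ?_
  rw [H.metric_christoffel hp, hm, hm, hm, (J.metric_and_connection hB hA hG hc hε₁ hp z w).1, hz,
    J.fderiv_fderiv_comm hp v u, J.fderiv_fderiv_comm hp w u, J.fderiv_fderiv_comm hp w v,
    S.christoffel_comm hy (fderiv ℝ j p v) (fderiv ℝ j p u),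
    S.christoffel_comm hy (fderiv ℝ j p w) (fderiv ℝ j p u),
    S.christoffel_comm hy (fderiv ℝ j p w) (fderiv ℝ j p v),
    S.metric_comm hy (fderiv ℝ j p u), S.metric_comm hy (fderiv ℝ j p v)]
  ring

theorem cubicForm_image (hε₁ : ε₁ ≠ 0) (hc0 : 0 < c) {p : Euc n₁} (hp : p ∈ U)
    (u v w : Euc n₁) : cubicForm ε₁ G p u v w = (-2 * c) *
      metric ε F (j p) (difference ε F (j p) (fderiv ℝ j p u) (fderiv ℝ j p v))
        (fderiv ℝ j p w) := by
  have H := J.convexParam hB hA hG hc hε₁ hc0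
  have hy := J.mapsTo hp
  have h1 : fderiv ℝ j p (difference ε₁ G p u v) =
      S.proj (j p) (difference ε F (j p) (fderiv ℝ j p u) (fderiv ℝ j p v)) := by
    have h2 := (J.metric_and_connection hB hA hG hc hε₁ hp u v).2
    rw [inducedConnection_eq, map_add, J.fderiv_christoffel hB hA hG hc hε₁ hc0 hp] at h2
    linear_combination (norm := module) h2
  rw [H.cubicForm_eq hp, (J.metric_and_connection hB hA hG hc hε₁ hp _ w).1, h1,
    S.metric_proj hy _ (J.tangent p hp w)]
  ring

/-- The cubic form is the restriction of the parallel tensor −2c h(K·,·) to a totally geodesic leaf.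
-/
theorem covDerivCubicForm_eq_zero (hε₁ : ε₁ ≠ 0) (hc0 : 0 < c) {p : Euc n₁} (hp : p ∈ U)
    (u v w z : Euc n₁) : covDerivCubicForm ε₁ G p u v w z = 0 := by
  have hy := J.mapsTo hp
  have h1 := ((((S.hasFDerivAt_metric hy).comp p (J.hasFDerivAt hp)).clm_apply
    ((((S.hasFDerivAt_difference hy).comp p (J.hasFDerivAt hp)).clm_apply
      ((J.hasFDerivAt_fderiv hp).clm_apply (hasFDerivAt_const v p))).clm_apply
      ((J.hasFDerivAt_fderiv hp).clm_apply (hasFDerivAt_const w p)))).clm_apply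
      ((J.hasFDerivAt_fderiv hp).clm_apply (hasFDerivAt_const z p))).const_smul (-2 * c)
  have h2 := h1.congr_of_eventuallyEq (f₁ := fun q => cubicForm ε₁ G q v w z)
    (Filter.eventually_of_mem (J.isOpen.mem_nhds hp) fun q hq =>
      J.cubicForm_image hB hA hG hc hε₁ hc0 hq v w z)
  rw [covDerivCubicForm, h2.fderiv]
  simp only [← christoffel_eq_metricConnection]
  rw [J.cubicForm_image hB hA hG hc hε₁ hc0 hp, J.cubicForm_image hB hA hG hc hε₁ hc0 hp,
    J.cubicForm_image hB hA hG hc hε₁ hc0 hp, J.fderiv_christoffel hB hA hG hc hε₁ hc0 hp,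
    J.fderiv_christoffel hB hA hG hc hε₁ hc0 hp, J.fderiv_christoffel hB hA hG hc hε₁ hc0 hp]
  simp [S.fderiv_metric hy, S.fderiv_difference hy (S.parallel _ hy _ _ _)]
  ring

end Image

end EigenSplitting.IsLeaf

end Leaves
end Centroaffine

/-! ### Inverse function theorem on a box, the potential of τ, and the rescaled components. -/

namespace Centroaffine
noncomputable section Coordinates

set_option maxSynthPendingDepth 5

variable {n : ℕ}

/-- The inverse function theorem, with a smooth inverse defined on a product of balls. -/
theorem exists_inverse_on_box {E E₁ E₂ : Type*} [NormedAddCommGroup E] [NormedSpace ℝ E]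
    [CompleteSpace E] [NormedAddCommGroup E₁] [NormedSpace ℝ E₁] [NormedAddCommGroup E₂]
    [NormedSpace ℝ E₂] {Θ : E → ℝ × E₁ × E₂} {Ω : Set E} (hΩ : IsOpen Ω)
    (hΘ : ContDiffOn ℝ ∞ Θ Ω) {x₀ : E} (hx₀ : x₀ ∈ Ω) (hinv : (fderiv ℝ Θ x₀).IsInvertible) :
    ∃ (r : ℝ) (Ψ : OpenPartialHomeomorph (ℝ × E₁ × E₂) E), 0 < r ∧
      Ψ.source = Metric.ball (Θ x₀).1 r ×ˢ Metric.ball (Θ x₀).2.1 r ×ˢ Metric.ball (Θ x₀).2.2 r ∧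
      Ψ.target ⊆ Ω ∧ x₀ ∈ Ψ.target ∧ ContDiffOn ℝ ∞ Ψ Ψ.source ∧
      ContDiffOn ℝ ∞ Ψ.symm Ψ.target ∧
      ∀ z ∈ Ψ.source, Θ (Ψ z) = z ∧ (fderiv ℝ Θ (Ψ z)).IsInvertible := by
  have hat : ∀ x ∈ Ω, ContDiffAt ℝ ∞ Θ x := fun x hx => hΘ.contDiffAt (hΩ.mem_nhds hx)
  obtain ⟨Θ', hΘ'⟩ := hinv
  have hd : HasFDerivAt Θ (Θ' : E →L[ℝ] ℝ × E₁ × E₂) x₀ := by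
    rw [hΘ']; exact ((hat x₀ hx₀).differentiableAt (by simp)).hasFDerivAt
  have hnear : ∀ᶠ x in nhds x₀, x ∈ Ω ∧ (fderiv ℝ Θ x).IsInvertible := by
    refine (hΩ.eventually_mem hx₀).and ?_
    have h1 : ContinuousAt (fderiv ℝ Θ) x₀ :=
      ((hat x₀ hx₀).fderiv_right (m := ∞) (by simp)).continuousAt
    have h2 := h1.eventually (hΘ' ▸ Θ'.nhds)
    filter_upwards [h2] with x hx
    obtain ⟨e, he⟩ := hx
    exact ⟨e, he⟩
  obtain ⟨N, hN, hNo, hx₀N⟩ := eventually_nhds_iff.1 hnear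
  let R := ((hat x₀ hx₀).toOpenPartialHomeomorph Θ hd (by simp)).restrOpen N hNo
  have hR : ∀ x, R x = Θ x := fun _ => rfl
  have hx₀R : x₀ ∈ R.source := by
    refine ⟨?_, hx₀N⟩
    exact (hat x₀ hx₀).mem_toOpenPartialHomeomorph_source hd (by simp)
  have hRN : R.source ⊆ N := fun x hx => hx.2
  obtain ⟨r, hr, hball⟩ := Metric.isOpen_iff.1 R.open_target (Θ x₀) (R.map_source hx₀R)
  -- In the sup norm a ball of the product is a product of balls.
  rw [← ball_prod_same, ← ball_prod_same] at hball
  have hbox : IsOpen (Metric.ball (Θ x₀).1 r ×ˢ Metric.ball (Θ x₀).2.1 r ×ˢ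
      Metric.ball (Θ x₀).2.2 r) :=
    Metric.isOpen_ball.prod (Metric.isOpen_ball.prod Metric.isOpen_ball)
  let Ψ := R.symm.restrOpen _ hbox
  have hsource : Ψ.source = Metric.ball (Θ x₀).1 r ×ˢ Metric.ball (Θ x₀).2.1 r ×ˢ
      Metric.ball (Θ x₀).2.2 r := Set.inter_eq_right.2 hball
  have hΨR : ∀ z ∈ Ψ.source, z ∈ R.target := fun z hz => hz.1
  have hΨN : ∀ z ∈ Ψ.source, Ψ z ∈ N := fun z hz => hRN (R.map_target (hΨR z hz))
  have htarget : ∀ x ∈ Ψ.target, x ∈ N := fun x hx => by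
    have := hΨN _ (Ψ.map_target hx)
    rwa [Ψ.right_inv hx] at this
  refine ⟨r, Ψ, hr, hsource, fun x hx => (hN x (htarget x hx)).1, ?_, ?_, ?_, fun z hz =>
    ⟨R.right_inv (hΨR z hz), (hN _ (hΨN z hz)).2⟩⟩
  · have h1 : Θ x₀ ∈ Ψ.source := by
      rw [hsource]
      exact ⟨Metric.mem_ball_self hr, Metric.mem_ball_self hr, Metric.mem_ball_self hr⟩
    have h2 : Ψ (Θ x₀) = x₀ := R.left_inv hx₀R
    rw [← h2]
    exact Ψ.map_source h1
  · intro z hz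
    obtain ⟨e, he⟩ := (hN _ (hΨN z hz)).2
    refine ContDiffAt.contDiffWithinAt (R.contDiffAt_symm (f₀' := e) (hΨR z hz) ?_
      (hat _ (hN _ (hΨN z hz)).1))
    rw [he]
    exact ((hat _ (hN _ (hΨN z hz)).1).differentiableAt (by simp)).hasFDerivAt
  · exact fun x hx => (hat x (hN x (htarget x hx)).1).contDiffWithinAt

/-- `G` parametrizes a locally strongly convex centroaffine hypersurface with parallel cubic
form. -/
structure ParallelConvexParam (ε : ℝ) (G : Euc n → Euc (n + 1)) (U : Set (Euc n)) : Prop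
    extends ConvexParam ε G U where
  sign : ε = 1 ∨ ε = -1
  parallel : ∀ p ∈ U, ∀ u v w z, covDerivCubicForm ε G p u v w z = 0

namespace EigenSplitting

variable {ε : ℝ} {F : Euc n → Euc (n + 1)} {Ω : Set (Euc n)} {τ : Euc n → Euc n}
  {D₂ D₃ : Euc n → Submodule ℝ (Euc n)} {n₁ n₂ : ℕ} {l₁ l₂ l₃ : ℝ}

theorem IsLeaf.exists_parallelConvexParam {S : EigenSplitting ε F Ω τ D₂ D₃ n₁ n₂ l₁ l₂ l₃}
    {j : Euc n₁ → Euc n} {U : Set (Euc n₁)} (J : S.IsLeaf j U) {x₀ : Euc n} (hx₀ : x₀ ∈ Ω)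
    {B : Euc (n + 1) →L[ℝ] Euc (n + 1)} (hB : ∀ x ∈ Ω, fderiv ℝ F x (τ x) = B (F x))
    {A : Euc (n + 1) →L[ℝ] Euc (n₁ + 1)} (hA : IsEigenProjection B l₂ A) :
    ∃ ε₁ : ℝ, ParallelConvexParam ε₁ (fun p => A (F (j p))) U := by
  -- From ε = λ₂λ₃ this number is λ₂(λ₃ − λ₂). Its sign becomes ε₁ and its absolute value the factor
  -- c.
  have hne : ε - l₂ ^ 2 ≠ 0 := by
    have h1 := S.eigenvalue_prod hx₀
    have h2 : l₂ ≠ 0 := fun h => S.sign_ne_zero (by rw [← h1, h, zero_mul])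
    have h3 : ε - l₂ ^ 2 = l₂ * (l₃ - l₂) := by rw [← h1]; ring
    rw [h3]
    exact mul_ne_zero h2 (sub_ne_zero.2 S.ne₂₃.symm)
  obtain ⟨ε₁, c, hs, hc0, hc⟩ : ∃ ε₁ c : ℝ, (ε₁ = 1 ∨ ε₁ = -1) ∧ 0 < c ∧ c * ε₁ = ε - l₂ ^ 2 := by
    rcases lt_or_gt_of_ne hne with h | h
    · exact ⟨-1, -(ε - l₂ ^ 2), Or.inr rfl, by linarith, by ring⟩
    · exact ⟨1, ε - l₂ ^ 2, Or.inl rfl, h, by ring⟩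
  have hε₁ : ε₁ ≠ 0 := by rcases hs with h | h <;> simp [h]
  exact ⟨ε₁, { J.convexParam hB hA (fun _ _ => rfl) hc hε₁ hc0 with
    sign := hs
    parallel := fun p hp u v w z =>
      J.covDerivCubicForm_eq_zero hB hA (fun _ _ => rfl) hc hε₁ hc0 hp u v w z }⟩

variable (S : EigenSplitting ε F Ω τ D₂ D₃ n₁ n₂ l₁ l₂ l₃)
include S

/-- The dual form of `τ` is closed. -/
theorem exists_potential (hΩ : Convex ℝ Ω) :
    ∃ t : Euc n → ℝ, ∀ x ∈ Ω, HasFDerivAt t (metric ε F x (τ x)) x := by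
  refine hΩ.exists_forall_hasFDerivAt_of_fderiv_symmetric S.isOpen
    (fun x hx => (S.fderiv_metric_field hx).differentiableAt.differentiableWithinAt)
    fun x hx u v => ?_
  rw [(S.fderiv_metric_field hx).fderiv]
  simp [S.christoffel_comm hx u v]

theorem contDiffOn_potential {t : Euc n → ℝ}
    (ht : ∀ x ∈ Ω, HasFDerivAt t (metric ε F x (τ x)) x) : ContDiffOn ℝ ∞ t Ω := by
  refine (contDiffOn_infty_iff_fderiv_of_isOpen S.isOpen).2
    ⟨fun x hx => (ht x hx).differentiableAt.differentiableWithinAt, ?_⟩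
  have h : ContDiffOn ℝ ∞ (fun x => metric ε F x (τ x)) Ω := fun x hx =>
    ((S.contDiffAt_metric hx).clm_apply
      (S.smooth_field.contDiffAt (S.isOpen.mem_nhds hx))).contDiffWithinAt
  exact h.congr fun x hx => (ht x hx).fderiv

section Component

variable {m : ℕ} {B : Euc (n + 1) →L[ℝ] Euc (n + 1)}
  (hB : ∀ x ∈ Ω, fderiv ℝ F x (τ x) = B (F x)) {A : Euc (n + 1) →L[ℝ] Euc (m + 1)}
  (hA : IsEigenProjection B l₂ A) {t : Euc n → ℝ}
  (ht : ∀ x ∈ Ω, HasFDerivAt t (metric ε F x (τ x)) x)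
include hB hA ht

/-- The exponential cancels the term λ₂h(τ,·)AF of `projection_fderiv`, so the rescaled component
varies only along D₂. -/
theorem hasFDerivAt_component {x : Euc n} (hx : x ∈ Ω) :
    HasFDerivAt (fun y => Real.exp (-l₂ * t y) • A (F y))
      (Real.exp (-l₂ * t x) • A.comp ((fderiv ℝ F x).comp (S.proj x))) x := by
  refine ((((ht x hx).const_mul (-l₂)).exp).smul
    (A.hasFDerivAt.comp x (S.hasFDerivAt_self hx))).congr_fderiv ?_
  ext1 v
  simp [S.projection_fderiv hB hA hx v]
  module

theorem component_const {Y : Type*} [NormedAddCommGroup Y] [NormedSpace ℝ Y] {γ : Y → Euc n}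
    {V : Set Y} (hV : IsOpen V) (hVc : Convex ℝ V) (hγ : Set.MapsTo γ V Ω)
    (hd : ∀ y ∈ V, DifferentiableAt ℝ γ y)
    (hp : ∀ y ∈ V, ∀ v, S.proj (γ y) (fderiv ℝ γ y v) = 0) {y z : Y} (hy : y ∈ V) (hz : z ∈ V) :
    Real.exp (-l₂ * t (γ y)) • A (F (γ y)) = Real.exp (-l₂ * t (γ z)) • A (F (γ z)) := by
  have h : ∀ y ∈ V, HasFDerivAt (𝕜 := ℝ)
      (fun y => Real.exp (-l₂ * t (γ y)) • A (F (γ y))) 0 y := fun y hy => by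
    refine ((S.hasFDerivAt_component hB hA ht (hγ hy)).comp y
      (hd y hy).hasFDerivAt).congr_fderiv ?_
    ext1 v
    simp [hp y hy]
  exact hVc.is_const_of_fderivWithin_eq_zero (𝕜 := ℝ)
    (fun y hy => (h y hy).differentiableAt.differentiableWithinAt)
    (fun y hy => by rw [fderivWithin_of_isOpen hV hy, (h y hy).fderiv]) hy hz

omit ht in
-- The rescaled component has values in a vector space of dimension m+1 but rank n₁; composing it
-- with π gives n₁ functions usable as coordinates along D₂.
theorem exists_transverse_projection {x : Euc n} (hx : x ∈ Ω) :
    ∃ π : Euc (m + 1) →L[ℝ] Euc n₁, ∀ v ∈ D₂ x, π (A (fderiv ℝ F x v)) = 0 → v = 0 := by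
  let g : D₂ x →ₗ[ℝ] Euc (m + 1) :=
    (A.comp (fderiv ℝ F x) : Euc n →ₗ[ℝ] Euc (m + 1)).comp (D₂ x).subtype
  have hg : g.ker = ⊥ := by
    refine LinearMap.ker_eq_bot'.2 fun v hv => ?_
    have h1 : A (fderiv ℝ F x v) + (0 : ℝ) • A (F x) = 0 := by
      rw [zero_smul, add_zero]; exact hv
    exact Subtype.ext (S.projection_independent hB hA hx v.2 h1).1
  obtain ⟨r, hr⟩ := g.exists_leftInverse_of_injective hg
  let e : D₂ x ≃ₗ[ℝ] Euc n₁ := LinearEquiv.ofFinrankEq _ _ (by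
    rw [S.finrank₂ x hx, finrank_euclideanSpace_fin])
  refine ⟨LinearMap.toContinuousLinearMap ((e : D₂ x →ₗ[ℝ] Euc n₁).comp r), fun v hv h => ?_⟩
  have h1 : r (g ⟨v, hv⟩) = ⟨v, hv⟩ := LinearMap.congr_fun hr ⟨v, hv⟩
  have h2 : e (r (g ⟨v, hv⟩)) = 0 := h
  rw [h1, LinearEquiv.map_eq_zero_iff] at h2
  exact congrArg Subtype.val h2

end Component

end EigenSplitting

end Coordinates
end Centroaffine

/-! ### Adapted coordinates and the Calabi product formula. -/

namespace Centroaffine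
noncomputable section CalabiCoordinates

set_option maxSynthPendingDepth 5

variable {n : ℕ}

theorem IsEigenProjection.of_splitting {N n₁ n₂ : ℕ} {B : Euc (N + 1) →L[ℝ] Euc (N + 1)}
    {l₂ l₃ : ℝ} (hl : l₂ ≠ l₃) (A : Euc (N + 1) ≃L[ℝ] Euc (n₁ + 1) × Euc (n₂ + 1))
    (hA : ∀ z, (A (B z)).1 = l₂ • (A z).1 ∧ (A (B z)).2 = l₃ • (A z).2) :
    IsEigenProjection B l₂ ((ContinuousLinearMap.fst ℝ (Euc (n₁ + 1)) (Euc (n₂ + 1))).comp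
      (A : Euc (N + 1) →L[ℝ] Euc (n₁ + 1) × Euc (n₂ + 1))) ∧
    IsEigenProjection B l₃ ((ContinuousLinearMap.snd ℝ (Euc (n₁ + 1)) (Euc (n₂ + 1))).comp
      (A : Euc (N + 1) →L[ℝ] Euc (n₁ + 1) × Euc (n₂ + 1))) := by
  refine ⟨⟨fun z => (hA z).1, fun z hz h1 => ?_⟩, ⟨fun z => (hA z).2, fun z hz h2 => ?_⟩⟩
  · have h2 := (hA z).2
    rw [hz, map_smul, Prod.smul_snd, ← sub_eq_zero, ← sub_smul] at h2
    refine A.map_eq_zero_iff.1 (Prod.ext h1 ((smul_eq_zero.1 h2).resolve_left ?_))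
    exact sub_ne_zero.2 hl
  · have h1 := (hA z).1
    rw [hz, map_smul, Prod.smul_fst, ← sub_eq_zero, ← sub_smul] at h1
    refine A.map_eq_zero_iff.1 (Prod.ext ((smul_eq_zero.1 h1).resolve_left ?_) h2)
    exact sub_ne_zero.2 hl.symm

namespace EigenSplitting

variable {ε : ℝ} {F : Euc n → Euc (n + 1)} {Ω : Set (Euc n)} {τ : Euc n → Euc n}
  {D₂ D₃ : Euc n → Submodule ℝ (Euc n)} {n₁ n₂ : ℕ} {l₁ l₂ l₃ : ℝ}

/-- A parametrization of `Ω` whose coordinate directions are `τ`, `D₂`, `D₃`. -/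
structure IsAdapted (S : EigenSplitting ε F Ω τ D₂ D₃ n₁ n₂ l₁ l₂ l₃)
    (Ψ : ℝ × Euc n₁ × Euc n₂ → Euc n) (t : Euc n → ℝ) (J : Set ℝ) (U₁ : Set (Euc n₁))
    (U₂ : Set (Euc n₂)) : Prop where
  isOpen : IsOpen J
  isOpen₁ : IsOpen U₁
  isOpen₂ : IsOpen U₂
  convex : Convex ℝ J
  convex₁ : Convex ℝ U₁
  convex₂ : Convex ℝ U₂
  smooth : ContDiffOn ℝ ∞ Ψ (J ×ˢ U₁ ×ˢ U₂)
  mapsTo : Set.MapsTo Ψ (J ×ˢ U₁ ×ˢ U₂) Ω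
  time : ∀ z ∈ J ×ˢ U₁ ×ˢ U₂, l₂ * t (Ψ z) = z.1
  injective : ∀ z ∈ J ×ˢ U₁ ×ˢ U₂, ∀ X, fderiv ℝ Ψ z X = 0 → X = 0
  metric_eq : ∀ z ∈ J ×ˢ U₁ ×ˢ U₂, ∀ X, X.1 = 0 →
    metric ε F (Ψ z) (τ (Ψ z)) (fderiv ℝ Ψ z X) = 0
  proj₁ : ∀ z ∈ J ×ˢ U₁ ×ˢ U₂, ∀ X, X.2.1 = 0 → S.proj (Ψ z) (fderiv ℝ Ψ z X) = 0
  proj₂ : ∀ z ∈ J ×ˢ U₁ ×ˢ U₂, ∀ X, X.2.2 = 0 → S.swap.proj (Ψ z) (fderiv ℝ Ψ z X) = 0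

namespace IsAdapted

variable {S : EigenSplitting ε F Ω τ D₂ D₃ n₁ n₂ l₁ l₂ l₃}
  {Ψ : ℝ × Euc n₁ × Euc n₂ → Euc n} {t : Euc n → ℝ} {J : Set ℝ} {U₁ : Set (Euc n₁)}
  {U₂ : Set (Euc n₂)} (P : S.IsAdapted Ψ t J U₁ U₂)
include P

theorem hasFDerivAt {z : ℝ × Euc n₁ × Euc n₂} (hz : z ∈ J ×ˢ U₁ ×ˢ U₂) :
    HasFDerivAt Ψ (fderiv ℝ Ψ z) z :=
  ((P.smooth.contDiffAt ((P.isOpen.prod (P.isOpen₁.prod P.isOpen₂)).mem_nhds hz)).differentiableAt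
    (by simp)).hasFDerivAt

/-- Directions with only a p-part have no τ- and no D₃-component, so the slices integrate D₂ without
appeal to Frobenius. -/
theorem isLeaf₁ {u : ℝ} (hu : u ∈ J) {q : Euc n₂} (hq : q ∈ U₂) :
    S.IsLeaf (fun p => Ψ (u, p, q)) U₁ := by
  have hd : ∀ p ∈ U₁, ∀ v, fderiv ℝ (fun p => Ψ (u, p, q)) p v =
      fderiv ℝ Ψ (u, p, q) (0, v, 0) := fun p hp v => by
    have h : HasFDerivAt (fun p : Euc n₁ => (u, p, q)) ((0 : Euc n₁ →L[ℝ] ℝ).prod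
        ((ContinuousLinearMap.id ℝ (Euc n₁)).prod (0 : Euc n₁ →L[ℝ] Euc n₂))) p :=
      (hasFDerivAt_const u p).prodMk ((hasFDerivAt_id p).prodMk (hasFDerivAt_const q p))
    have h' : HasFDerivAt (fun p => Ψ (u, p, q)) _ p :=
      (P.hasFDerivAt (z := (u, p, q)) ⟨hu, hp, hq⟩).comp p h
    rw [h'.fderiv]
    rfl
  have hmap : Set.MapsTo (fun p : Euc n₁ => (u, p, q)) U₁ (J ×ˢ U₁ ×ˢ U₂) :=
    fun p hp => ⟨hu, hp, hq⟩
  refine ⟨P.isOpen₁, P.smooth.comp ?_ hmap, P.mapsTo.comp hmap, fun p hp v => ?_,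
    fun p hp v hv => ?_⟩
  · exact (contDiff_const.prodMk (contDiff_id.prodMk contDiff_const)).contDiffOn
  · have hz := hmap hp
    rw [hd p hp]
    have h := S.eq_add_proj (P.mapsTo hz) (fderiv ℝ Ψ (u, p, q) (0, v, 0))
    rw [P.metric_eq _ hz _ rfl, P.proj₂ _ hz _ rfl, zero_smul, zero_add, add_zero] at h
    rw [h]
    exact S.proj_mem (P.mapsTo hz) _
  · rw [hd p hp] at hv
    exact congrArg (fun X => X.2.1) (P.injective _ (hmap hp) _ hv)

theorem isLeaf₂ {u : ℝ} (hu : u ∈ J) {p : Euc n₁} (hp : p ∈ U₁) :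
    S.swap.IsLeaf (fun q => Ψ (u, p, q)) U₂ := by
  have hd : ∀ q ∈ U₂, ∀ v, fderiv ℝ (fun q => Ψ (u, p, q)) q v =
      fderiv ℝ Ψ (u, p, q) (0, 0, v) := fun q hq v => by
    have h : HasFDerivAt (fun q : Euc n₂ => (u, p, q)) ((0 : Euc n₂ →L[ℝ] ℝ).prod
        ((0 : Euc n₂ →L[ℝ] Euc n₁).prod (ContinuousLinearMap.id ℝ (Euc n₂)))) q :=
      (hasFDerivAt_const u q).prodMk ((hasFDerivAt_const p q).prodMk (hasFDerivAt_id q))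
    have h' : HasFDerivAt (fun q => Ψ (u, p, q)) _ q :=
      (P.hasFDerivAt (z := (u, p, q)) ⟨hu, hp, hq⟩).comp q h
    rw [h'.fderiv]
    rfl
  have hmap : Set.MapsTo (fun q : Euc n₂ => (u, p, q)) U₂ (J ×ˢ U₁ ×ˢ U₂) :=
    fun q hq => ⟨hu, hp, hq⟩
  refine ⟨P.isOpen₂, P.smooth.comp ?_ hmap, P.mapsTo.comp hmap, fun q hq v => ?_,
    fun q hq v hv => ?_⟩
  · exact (contDiff_const.prodMk (contDiff_const.prodMk contDiff_id)).contDiffOn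
  · have hz := hmap hq
    rw [hd q hq]
    have h := S.eq_add_proj (P.mapsTo hz) (fderiv ℝ Ψ (u, p, q) (0, 0, v))
    rw [P.metric_eq _ hz _ rfl, P.proj₁ _ hz _ rfl, zero_smul, zero_add, zero_add] at h
    rw [h]
    exact S.swap.proj_mem (P.mapsTo hz) _
  · rw [hd q hq] at hv
    exact congrArg (fun X => X.2.2) (P.injective _ (hmap hq) _ hv)

variable {B : Euc (n + 1) →L[ℝ] Euc (n + 1)}
  (hB : ∀ x ∈ Ω, fderiv ℝ F x (τ x) = B (F x))
  (ht : ∀ x ∈ Ω, HasFDerivAt t (metric ε F x (τ x)) x)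
include hB ht

/-- Moving u and q alone has no D₂-component, so `component_const` applies. -/
theorem component₁ {m : ℕ} {A : Euc (n + 1) →L[ℝ] Euc (m + 1)} (hA : IsEigenProjection B l₂ A)
    {u u' : ℝ} (hu : u ∈ J) (hu' : u' ∈ J) {p : Euc n₁} (hp : p ∈ U₁) {q q' : Euc n₂}
    (hq : q ∈ U₂) (hq' : q' ∈ U₂) : Real.exp (-l₂ * t (Ψ (u, p, q))) • A (F (Ψ (u, p, q))) =
      Real.exp (-l₂ * t (Ψ (u', p, q'))) • A (F (Ψ (u', p, q'))) := by
  have hd : ∀ y ∈ J ×ˢ U₂, HasFDerivAt (fun y : ℝ × Euc n₂ => Ψ (y.1, p, y.2))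
      ((fderiv ℝ Ψ (y.1, p, y.2)).comp ((ContinuousLinearMap.fst ℝ ℝ (Euc n₂)).prod
        ((0 : ℝ × Euc n₂ →L[ℝ] Euc n₁).prod (ContinuousLinearMap.snd ℝ ℝ (Euc n₂))))) y :=
    fun y hy => (P.hasFDerivAt (z := (y.1, p, y.2)) ⟨hy.1, hp, hy.2⟩).comp y
      (hasFDerivAt_fst.prodMk ((hasFDerivAt_const p y).prodMk hasFDerivAt_snd))
  exact S.component_const hB hA ht (γ := fun y : ℝ × Euc n₂ => Ψ (y.1, p, y.2))
    (P.isOpen.prod P.isOpen₂) (P.convex.prod P.convex₂)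
    (fun y hy => P.mapsTo ⟨hy.1, hp, hy.2⟩) (fun y hy => (hd y hy).differentiableAt)
    (fun y hy v => by
      rw [(hd y hy).fderiv]
      exact P.proj₁ (y.1, p, y.2) ⟨hy.1, hp, hy.2⟩ _ rfl)
    (y := (u, q)) (z := (u', q')) ⟨hu, hq⟩ ⟨hu', hq'⟩

theorem component₂ {m : ℕ} {A : Euc (n + 1) →L[ℝ] Euc (m + 1)} (hA : IsEigenProjection B l₃ A)
    {u u' : ℝ} (hu : u ∈ J) (hu' : u' ∈ J) {p p' : Euc n₁} (hp : p ∈ U₁) (hp' : p' ∈ U₁)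
    {q : Euc n₂} (hq : q ∈ U₂) : Real.exp (-l₃ * t (Ψ (u, p, q))) • A (F (Ψ (u, p, q))) =
      Real.exp (-l₃ * t (Ψ (u', p', q))) • A (F (Ψ (u', p', q))) := by
  have hd : ∀ y ∈ J ×ˢ U₁, HasFDerivAt (fun y : ℝ × Euc n₁ => Ψ (y.1, y.2, q))
      ((fderiv ℝ Ψ (y.1, y.2, q)).comp ((ContinuousLinearMap.fst ℝ ℝ (Euc n₁)).prod
        ((ContinuousLinearMap.snd ℝ ℝ (Euc n₁)).prod (0 : ℝ × Euc n₁ →L[ℝ] Euc n₂)))) y :=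
    fun y hy => (P.hasFDerivAt (z := (y.1, y.2, q)) ⟨hy.1, hy.2, hq⟩).comp y
      (hasFDerivAt_fst.prodMk (hasFDerivAt_snd.prodMk (hasFDerivAt_const q y)))
  exact S.swap.component_const hB hA ht (γ := fun y : ℝ × Euc n₁ => Ψ (y.1, y.2, q))
    (P.isOpen.prod P.isOpen₁) (P.convex.prod P.convex₁)
    (fun y hy => P.mapsTo ⟨hy.1, hy.2, hq⟩) (fun y hy => (hd y hy).differentiableAt)
    (fun y hy v => by
      rw [(hd y hy).fderiv]
      exact P.proj₂ (y.1, y.2, q) ⟨hy.1, hy.2, hq⟩ _ rfl)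
    (y := (u, p)) (z := (u', p')) ⟨hu, hp⟩ ⟨hu', hp'⟩

end IsAdapted

theorem eigenvalue_ne_zero (S : EigenSplitting ε F Ω τ D₂ D₃ n₁ n₂ l₁ l₂ l₃) {x : Euc n}
    (hx : x ∈ Ω) : l₂ ≠ 0 := fun h =>
  S.sign_ne_zero (by rw [← S.eigenvalue_prod hx, h, zero_mul])

theorem exists_isAdapted (S : EigenSplitting ε F Ω τ D₂ D₃ n₁ n₂ l₁ l₂ l₃) {x₀ : Euc n}
    (hx₀ : x₀ ∈ Ω) {B : Euc (n + 1) →L[ℝ] Euc (n + 1)}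
    (hB : ∀ x ∈ Ω, fderiv ℝ F x (τ x) = B (F x)) {A₁ : Euc (n + 1) →L[ℝ] Euc (n₁ + 1)}
    (hA₁ : IsEigenProjection B l₂ A₁) {A₂ : Euc (n + 1) →L[ℝ] Euc (n₂ + 1)}
    (hA₂ : IsEigenProjection B l₃ A₂) {t : Euc n → ℝ}
    (ht : ∀ x ∈ Ω, HasFDerivAt t (metric ε F x (τ x)) x) :
    ∃ (u₀ : ℝ) (p₀ : Euc n₁) (q₀ : Euc n₂) (r : ℝ)
      (Ψ : OpenPartialHomeomorph (ℝ × Euc n₁ × Euc n₂) (Euc n)), 0 < r ∧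
      Ψ.source = Metric.ball u₀ r ×ˢ Metric.ball p₀ r ×ˢ Metric.ball q₀ r ∧
      Ψ.target ⊆ Ω ∧ x₀ ∈ Ψ.target ∧ ContDiffOn ℝ ∞ Ψ Ψ.source ∧
      ContDiffOn ℝ ∞ Ψ.symm Ψ.target ∧
      S.IsAdapted Ψ t (Metric.ball u₀ r) (Metric.ball p₀ r) (Metric.ball q₀ r) := by
  have hl₂ := S.eigenvalue_ne_zero hx₀
  obtain ⟨π₁, hπ₁⟩ := S.exists_transverse_projection hB hA₁ hx₀
  obtain ⟨π₂, hπ₂⟩ := S.swap.exists_transverse_projection hB hA₂ hx₀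
  -- The three entries have differentials sensitive only to τ, D₂ and D₃ respectively. Using λ₂t
  -- instead of t makes the first factor of the product exactly exp(u).
  let Θ : Euc n → ℝ × Euc n₁ × Euc n₂ := fun x => (l₂ * t x,
    π₁ (Real.exp (-l₂ * t x) • A₁ (F x)), π₂ (Real.exp (-l₃ * t x) • A₂ (F x)))
  have hts := S.contDiffOn_potential ht
  have hΘs : ContDiffOn ℝ ∞ Θ Ω := by
    refine (contDiffOn_const.mul hts).prodMk (ContDiffOn.prodMk ?_ ?_)
    · exact π₁.contDiff.comp_contDiffOn ((contDiffOn_const.mul hts).exp.smul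
        (A₁.contDiff.comp_contDiffOn S.smooth))
    · exact π₂.contDiff.comp_contDiffOn ((contDiffOn_const.mul hts).exp.smul
        (A₂.contDiff.comp_contDiffOn S.smooth))
  have hΘ : ∀ x ∈ Ω, ∀ v, fderiv ℝ Θ x v = (l₂ * metric ε F x (τ x) v,
      Real.exp (-l₂ * t x) • π₁ (A₁ (fderiv ℝ F x (S.proj x v))),
      Real.exp (-l₃ * t x) • π₂ (A₂ (fderiv ℝ F x (S.swap.proj x v)))) := fun x hx v => by
    have h : HasFDerivAt Θ _ x := ((ht x hx).const_mul l₂).prodMk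
      ((π₁.hasFDerivAt.comp x (S.hasFDerivAt_component hB hA₁ ht hx)).prodMk
        (π₂.hasFDerivAt.comp x (S.swap.hasFDerivAt_component hB hA₂ ht hx)))
    rw [h.fderiv]
    simp
  have hinj : Function.Injective (fderiv ℝ Θ x₀) := by
    refine (injective_iff_map_eq_zero _).2 fun v hv => ?_
    rw [hΘ x₀ hx₀] at hv
    simp only [Prod.mk_eq_zero, smul_eq_zero, Real.exp_ne_zero, mul_eq_zero, hl₂, false_or] at hv
    rw [S.eq_add_proj hx₀ v, hv.1, hπ₁ _ (S.proj_mem hx₀ v) hv.2.1,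
      hπ₂ _ (S.swap.proj_mem hx₀ v) hv.2.2]
    simp
  obtain ⟨r, Ψ, hr, hsource, htarget, hmem, hs, hs', hΨ⟩ := exists_inverse_on_box S.isOpen hΘs hx₀
    (isInvertible_of_injective _ hinj (by simp [← S.dim, add_assoc]))
  refine ⟨_, _, _, r, Ψ, hr, hsource, htarget, hmem, hs, hs', ?_⟩
  have hmaps : ∀ z ∈ Ψ.source, Ψ z ∈ Ω := fun z hz => htarget (Ψ.map_source hz)
  have hcomp : ∀ z ∈ Ψ.source, ∀ X, fderiv ℝ Θ (Ψ z) (fderiv ℝ Ψ z X) = X := fun z hz X => by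
    have h1 : HasFDerivAt Ψ (fderiv ℝ Ψ z) z :=
      ((hs.contDiffAt (Ψ.open_source.mem_nhds hz)).differentiableAt (by simp)).hasFDerivAt
    have h2 : HasFDerivAt Θ (fderiv ℝ Θ (Ψ z)) (Ψ z) :=
      ((hΘs.contDiffAt (S.isOpen.mem_nhds (hmaps z hz))).differentiableAt (by simp)).hasFDerivAt
    have h3 := (h2.comp z h1).congr_of_eventuallyEq (f₁ := id)
      (Filter.eventually_of_mem (Ψ.open_source.mem_nhds hz) fun y hy => (hΨ y hy).1.symm)
    exact congrArg (fun L => L X) (h3.unique (hasFDerivAt_id z))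
  have hker : ∀ z ∈ Ψ.source, ∀ v, fderiv ℝ Θ (Ψ z) v = 0 → v = 0 := fun z hz v hv =>
    (hΨ z hz).2.injective (by rw [hv, map_zero])
  have hkey : ∀ z ∈ Ψ.source, ∀ X : ℝ × Euc n₁ × Euc n₂,
      (X.1 = 0 → metric ε F (Ψ z) (τ (Ψ z)) (fderiv ℝ Ψ z X) = 0) ∧
      (X.2.1 = 0 → S.proj (Ψ z) (fderiv ℝ Ψ z X) = 0) ∧
      (X.2.2 = 0 → S.swap.proj (Ψ z) (fderiv ℝ Ψ z X) = 0) := fun z hz X => by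
    have hy := hmaps z hz
    have h := hcomp z hz X
    rw [hΘ _ hy] at h
    have h1 := congrArg Prod.fst h
    have h2 := congrArg (fun X => X.2.1) h
    have h3 := congrArg (fun X => X.2.2) h
    simp only at h1 h2 h3
    refine ⟨fun h0 => ?_, fun h0 => ?_, fun h0 => ?_⟩
    · rw [h0] at h1
      exact (mul_eq_zero.1 h1).resolve_left hl₂
    · rw [h0] at h2
      refine hker z hz _ ?_
      have hm := S.proj_mem hy (fderiv ℝ Ψ z X)
      have e : S.swap.proj (Ψ z) (S.proj (Ψ z) (fderiv ℝ Ψ z X)) = 0 := by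
        simpa using S.swap.proj_eq hy 0 (zero_mem _) hm
      rw [hΘ _ hy, S.orth₂ _ hy _ hm, S.proj_of_mem hy hm, h2, e]
      simp
    · rw [h0] at h3
      refine hker z hz _ ?_
      have hm := S.swap.proj_mem hy (fderiv ℝ Ψ z X)
      have e : S.proj (Ψ z) (S.swap.proj (Ψ z) (fderiv ℝ Ψ z X)) = 0 := by
        simpa using S.proj_eq hy 0 (zero_mem _) hm
      rw [hΘ _ hy, S.orth₃ _ hy _ hm, S.swap.proj_of_mem hy hm, h3, e]
      simp
  exact {
    isOpen := Metric.isOpen_ball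
    isOpen₁ := Metric.isOpen_ball
    isOpen₂ := Metric.isOpen_ball
    convex := convex_ball _ _
    convex₁ := convex_ball _ _
    convex₂ := convex_ball _ _
    smooth := hsource ▸ hs
    mapsTo := hsource ▸ hmaps
    time := hsource ▸ fun z hz => congrArg Prod.fst (hΨ z hz).1
    injective := hsource ▸ fun z hz X hX => by
      rw [← hcomp z hz X, hX, map_zero]
    metric_eq := hsource ▸ fun z hz X => (hkey z hz X).1
    proj₁ := hsource ▸ fun z hz X => (hkey z hz X).2.1
    proj₂ := hsource ▸ fun z hz X => (hkey z hz X).2.2 }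

theorem exists_calabi_coordinates (S : EigenSplitting ε F Ω τ D₂ D₃ n₁ n₂ l₁ l₂ l₃)
    (hΩ : Convex ℝ Ω) {x₀ : Euc n} (hx₀ : x₀ ∈ Ω) :
    ∃ (J : Set ℝ) (U₁ : Set (Euc n₁)) (U₂ : Set (Euc n₂)) (G₁ : Euc n₁ → Euc (n₁ + 1))
      (G₂ : Euc n₂ → Euc (n₂ + 1)) (ε₁ ε₂ : ℝ)
      (A : Euc (n + 1) ≃L[ℝ] Euc (n₁ + 1) × Euc (n₂ + 1))
      (Ψ : OpenPartialHomeomorph (ℝ × Euc n₁ × Euc n₂) (Euc n)), IsOpen J ∧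
      ParallelConvexParam ε₁ G₁ U₁ ∧ ParallelConvexParam ε₂ G₂ U₂ ∧
      Ψ.source = J ×ˢ U₁ ×ˢ U₂ ∧ Ψ.target ⊆ Ω ∧ x₀ ∈ Ψ.target ∧ ContDiffOn ℝ ∞ Ψ Ψ.source ∧
      ContDiffOn ℝ ∞ Ψ.symm Ψ.target ∧ ∀ u ∈ J, ∀ p ∈ U₁, ∀ q ∈ U₂,
        A (F (Ψ (u, p, q))) = calabiProduct (-(l₃ / l₂)) G₁ G₂ u p q := by
  have hl₂ := S.eigenvalue_ne_zero hx₀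
  obtain ⟨B, hB⟩ := S.exists_endomorphism hΩ
  obtain ⟨t, ht⟩ := S.exists_potential hΩ
  obtain ⟨A, hA⟩ := exists_eigen_splitting (n₁ := n₁) (n₂ := n₂) (by have := S.dim; omega) B S.ne₂₃
    (S.finrank_eigenspace hB hx₀) (S.swap.finrank_eigenspace hB hx₀)
  obtain ⟨hA₁, hA₂⟩ := IsEigenProjection.of_splitting S.ne₂₃ A hA
  obtain ⟨u₀, p₀, q₀, r, Ψ, hr, hsource, htarget, hmem, hs, hs', P⟩ :=
    S.exists_isAdapted hx₀ hB hA₁ hA₂ ht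
  have hu₀ := Metric.mem_ball_self (x := u₀) hr
  have hp₀ := Metric.mem_ball_self (x := p₀) hr
  have hq₀ := Metric.mem_ball_self (x := q₀) hr
  -- With u = λ₂t, the second component scales by exp(λ₃t) = exp(μu), so μ = −λ.
  set μ := l₃ / l₂ with hμ
  -- ψ₁ is read off the slice u = u₀, q = q₀; scaling the projection by exp(−u₀) removes the factor
  -- exp(u₀) present there. The second factor is normalised likewise.
  obtain ⟨ε₁, h₁⟩ := (P.isLeaf₁ hu₀ hq₀).exists_parallelConvexParam hx₀ hB
    (hA₁.smul (Real.exp_ne_zero (-u₀)))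
  obtain ⟨ε₂, h₂⟩ := (P.isLeaf₂ hu₀ hp₀).exists_parallelConvexParam hx₀ hB
    (hA₂.smul (Real.exp_ne_zero (-(μ * u₀))))
  refine ⟨_, _, _, _, _, ε₁, ε₂, A, Ψ, Metric.isOpen_ball, h₁, h₂, hsource, htarget, hmem, hs, hs',
    fun u hu p hp q hq => ?_⟩
  have hexp : ∀ u ∈ Metric.ball u₀ r, ∀ p ∈ Metric.ball p₀ r, ∀ q ∈ Metric.ball q₀ r,
      -l₂ * t (Ψ (u, p, q)) = -u ∧ -l₃ * t (Ψ (u, p, q)) = -(μ * u) := fun u hu p hp q hq => by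
    have h : l₂ * t (Ψ (u, p, q)) = u := P.time (u, p, q) ⟨hu, hp, hq⟩
    refine ⟨by rw [neg_mul, h], ?_⟩
    have e : l₃ = μ * l₂ := by rw [hμ, div_mul_cancel₀ _ hl₂]
    rw [e, neg_mul, mul_assoc, h]
  have c₁ := P.component₁ hB ht hA₁ hu hu₀ hp hq hq₀
  have c₂ := P.component₂ hB ht hA₂ hu hu₀ hp hp₀ hq
  rw [(hexp u hu p hp q hq).1, (hexp u₀ hu₀ p hp q₀ hq₀).1, Real.exp_neg,
    inv_smul_eq_iff₀ (Real.exp_ne_zero _)] at c₁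
  rw [(hexp u hu p hp q hq).2, (hexp u₀ hu₀ p₀ hp₀ q hq).2, Real.exp_neg,
    inv_smul_eq_iff₀ (Real.exp_ne_zero _)] at c₂
  refine Prod.ext c₁ ?_
  rw [calabiProduct, neg_neg]
  exact c₂

end EigenSplitting

end CalabiCoordinates
end Centroaffine

/-! ### Passage between local parametrizations and hypersurfaces on manifolds. -/

namespace Centroaffine

section Germs

variable {n : ℕ} {ε : ℝ} {F G : Euc n → Euc (n + 1)} {x : Euc n}

/-- A map read in a chart agrees with its parametrization only on the chart's target, so the
invariants are shown to depend on germs alone. -/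
theorem metric_congr (h : F =ᶠ[nhds x] G) : metric ε F x = metric ε G x := by
  simp only [metric, gaussFrame, h.eq_of_nhds, h.fderiv_eq, h.fderiv.fderiv_eq]

theorem inducedConnection_congr (h : F =ᶠ[nhds x] G) :
    inducedConnection ε F x = inducedConnection ε G x := by
  simp only [inducedConnection, gaussFrame, h.eq_of_nhds, h.fderiv_eq, h.fderiv.fderiv_eq]

theorem metric_eventuallyEq (h : F =ᶠ[nhds x] G) : metric ε F =ᶠ[nhds x] metric ε G :=
  h.eventuallyEq_nhds.mono fun _ hy => metric_congr hy

theorem metricConnection_congr (h : F =ᶠ[nhds x] G) (u v : Euc n) :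
    metricConnection ε F x u v = metricConnection ε G x u v := by
  simp only [metricConnection, leviCivita, metric_congr h, (metric_eventuallyEq h).fderiv_eq]

theorem cubicForm_congr (h : F =ᶠ[nhds x] G) (u v w : Euc n) :
    cubicForm ε F x u v w = cubicForm ε G x u v w := by
  have h1 : (fun y => metric ε F y v w) =ᶠ[nhds x] fun y => metric ε G y v w :=
    (metric_eventuallyEq (ε := ε) h).mono fun y hy => by simp only [hy]
  simp only [cubicForm, metric_congr h, inducedConnection_congr h, h1.fderiv_eq]

theorem covDerivCubicForm_congr (h : F =ᶠ[nhds x] G) (u v w z : Euc n) :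
    covDerivCubicForm ε F x u v w z = covDerivCubicForm ε G x u v w z := by
  have h1 : (fun y => cubicForm ε F y v w z) =ᶠ[nhds x] fun y => cubicForm ε G y v w z :=
    h.eventuallyEq_nhds.mono fun y hy => cubicForm_congr hy v w z
  simp only [covDerivCubicForm, cubicForm_congr h, metricConnection_congr h, h1.fderiv_eq]

end Germs

section OpenDomains

variable {m : ℕ} {U : TopologicalSpace.Opens (Euc m)}

theorem opens_chart_coe {e : OpenPartialHomeomorph U (Euc m)} (he : e ∈ atlas (Euc m) U) (p : U) :
    e p = p := by
  obtain ⟨x, rfl⟩ := TopologicalSpace.Opens.chart_eq ⟨p⟩ he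
  rfl

theorem opens_chart_symm {e : OpenPartialHomeomorph U (Euc m)} (he : e ∈ atlas (Euc m) U)
    {y : Euc m} (hy : y ∈ e.target) : (e.symm y : Euc m) = y := by
  rw [← opens_chart_coe he, e.right_inv hy]

theorem ParallelConvexParam.opens {ε : ℝ} {G : Euc m → Euc (m + 1)}
    (H : ParallelConvexParam ε G (U : Set (Euc m))) :
    IsLocallyStronglyConvex ε (fun p : U => G p) ∧
      HasParallelCubicForm ε (fun p : U => G p) := by
  have hgerm : ∀ e ∈ atlas (Euc m) U, ∀ y ∈ e.target,
      y ∈ U ∧ (fun p : U => G p) ∘ e.symm =ᶠ[nhds y] G := fun e he y hy => by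
    refine ⟨opens_chart_symm he hy ▸ (e.symm y).2, ?_⟩
    filter_upwards [e.open_target.mem_nhds hy] with z hz
    simp only [Function.comp_apply, opens_chart_symm he hz]
  have hcoe : ∀ p : U, ContMDiffAt (𝓡 m) (𝓡 m) ∞ (Subtype.val : U → Euc m) p :=
    fun p => contMDiff_subtype_val.contMDiffAt
  have hmf : ∀ p : U, mfderiv (𝓡 m) (𝓡 (m + 1)) (fun p : U => G p) p =
      (fderiv ℝ G p).comp (mfderiv (𝓡 m) (𝓡 m) (Subtype.val : U → Euc m) p) := fun p => by
    have h := mfderiv_comp p (g := G) (f := (Subtype.val : U → Euc m))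
      ((H.contDiffAt p.2).differentiableAt (by simp)).mdifferentiableAt
      ((hcoe p).mdifferentiableAt (by simp))
    rw [mfderiv_eq_fderiv] at h
    exact h
  have hinj : ∀ p : U, Function.Injective (mfderiv (𝓡 m) (𝓡 m) (Subtype.val : U → Euc m) p) :=
    fun p => by
      have h := (mdifferentiable_chart (I := 𝓡 m) p).mfderiv_injective (mem_chart_source (Euc m) p)
      have e : (chartAt (Euc m) p : U → Euc m) = Subtype.val :=
        funext fun q => opens_chart_coe (chart_mem_atlas (Euc m) p) q
      rwa [e] at h
  refine ⟨⟨⟨fun p => ?_, fun p => ?_, fun p => ?_⟩, H.sign, fun e he y hy v hv => ?_⟩,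
    fun e he y hy u v w z => ?_⟩
  · exact (H.contDiffAt p.2).contMDiffAt.comp p (hcoe p)
  · rw [hmf p]
    refine Function.Injective.comp (g := fderiv ℝ G p) ?_ (hinj p)
    refine (injective_iff_map_eq_zero _).2 fun v hv => ?_
    refine (H.frame_injective p.2 (v := v) (w := 0) (c := 0) (d := 0) ?_).1
    rw [hv, map_zero]
  · rw [hmf p]
    rintro ⟨v, hv⟩
    have hε : ε ≠ 0 := by rcases H.sign with h | h <;> simp [h]
    have h1 : fderiv ℝ G p (mfderiv (𝓡 m) (𝓡 m) (Subtype.val : U → Euc m) p v) = G p := hv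
    have h2 := (H.frame_injective p.2
      (v := (mfderiv (𝓡 m) (𝓡 m) (Subtype.val : U → Euc m) p v)) (w := 0) (c := ε⁻¹) (d := 0) (by
        rw [h1, smul_neg, inv_smul_smul₀ hε]; simp)).2
    exact inv_ne_zero hε h2
  · obtain ⟨hyU, h⟩ := hgerm e he y hy
    rw [metric_congr h]
    exact H.pos y hyU v hv
  · obtain ⟨hyU, h⟩ := hgerm e he y hy
    rw [covDerivCubicForm_congr h]
    exact H.parallel y hyU u v w z

end OpenDomains

section Charts

variable {n : ℕ} {M : Type*} [TopologicalSpace M] [ChartedSpace (Euc n) M] [IsManifold (𝓡 n) ∞ M]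
  {e : OpenPartialHomeomorph M (Euc n)}

theorem IsLocallyStronglyConvex.convexParam {ε : ℝ} {ψ : M → Euc (n + 1)}
    (hψ : IsLocallyStronglyConvex ε ψ) (he : e ∈ atlas (Euc n) M) :
    ConvexParam ε (ψ ∘ e.symm) e.target := by
  have hε : ε ≠ 0 := by rcases hψ.sign with h | h <;> simp [h]
  have hsymm : ContMDiffOn (𝓡 n) (𝓡 n) ∞ e.symm e.target :=
    contMDiffOn_symm_of_mem_maximalAtlas (IsManifold.subset_maximalAtlas he)
  have : IsManifold (𝓡 n) 1 M := .of_le (n := ∞) (by simp)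
  have hmd := mdifferentiable_of_mem_atlas (I := 𝓡 n) he
  refine ⟨e.open_target, ?_, fun y hy => isInvertible_gaussFrame fun v c h => ?_,
    fun y hy v hv => hψ.pos e he y hy v hv⟩
  · exact contMDiffOn_iff_contDiffOn.1 (hψ.centroaffine.smooth.comp_contMDiffOn hsymm)
  · have hf : fderiv ℝ (ψ ∘ e.symm) y v = mfderiv (𝓡 n) (𝓡 (n + 1)) ψ (e.symm y)
        (mfderiv (𝓡 n) (𝓡 n) e.symm y v) := by
      have h := mfderiv_comp y (I'' := 𝓡 (n + 1)) (g := ψ) (f := e.symm)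
        (hψ.centroaffine.smooth.mdifferentiable (by simp) _) (hmd.mdifferentiableAt_symm hy)
      rw [mfderiv_eq_fderiv] at h
      rw [h]
      rfl
    have hc : c = 0 := by
      -- Otherwise the position vector would be (cε)⁻¹ times the tangent vector dF(v), against
      -- transversality.
      by_contra hc
      refine hψ.centroaffine.transversal (e.symm y)
        ⟨(c * ε)⁻¹ • mfderiv (𝓡 n) (𝓡 n) e.symm y v, ?_⟩
      rw [map_smul]
      refine (inv_smul_eq_iff₀ (mul_ne_zero hc hε)).2 ?_
      refine hf.symm.trans ?_
      rw [smul_neg, ← sub_eq_add_neg, sub_eq_zero, smul_smul] at h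
      exact h
    refine ⟨?_, hc⟩
    rw [hc, zero_smul, add_zero] at h
    refine (injective_iff_map_eq_zero _).1 (hmd.symm.mfderiv_injective hy) v ?_
    exact (injective_iff_map_eq_zero _).1 (hψ.centroaffine.immersion (e.symm y)) _ (hf.symm.trans h)

theorem contDiffOn_chart_field {T : (p : M) → TangentSpace (𝓡 n) p}
    (hT : ContMDiff (𝓡 n) (𝓡 n).tangent ∞ (fun p => (⟨p, T p⟩ : TangentBundle (𝓡 n) M)))
    (he : e ∈ atlas (Euc n) M) :
    ContDiffOn ℝ ∞ (fun y => (mfderiv (𝓡 n) (𝓡 n) e (e.symm y) (T (e.symm y)) : Euc n))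
      e.target := by
  have hs : ContMDiffOn (𝓡 n) (𝓡 n) ∞ e e.source :=
    contMDiffOn_of_mem_maximalAtlas (IsManifold.subset_maximalAtlas he)
  have hsymm : ContMDiffOn (𝓡 n) (𝓡 n) ∞ e.symm e.target :=
    contMDiffOn_symm_of_mem_maximalAtlas (IsManifold.subset_maximalAtlas he)
  have h1 := hs.contMDiffOn_tangentMapWithin (m := ∞) (by simp) e.open_source.uniqueMDiffOn
  have h2 := (contMDiff_snd_tangentBundle_modelSpace (Euc n) (𝓡 n) (n := ∞)).comp_contMDiffOn
    (h1.comp (hT.comp_contMDiffOn hsymm) fun y hy => e.map_target hy)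
  refine (contMDiffOn_iff_contDiffOn.1 h2).congr fun y hy => ?_
  have h3 := mfderivWithin_of_isOpen (I := 𝓡 n) (I' := 𝓡 n) (f := e) e.open_source
    (e.map_target hy)
  exact congrArg (fun L => L (T (e.symm y))) h3.symm

end Charts

end Centroaffine

/-! ### The eigenvalue splitting in a chart, and the conclusion. -/

namespace Centroaffine

section ChartSplitting

variable {n : ℕ} {M : Type*} [TopologicalSpace M] [ChartedSpace (Euc n) M] [IsManifold (𝓡 n) ∞ M]

/-- The chart expression of a distribution. -/
noncomputable def chartDistribution (e : OpenPartialHomeomorph M (Euc n))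
    (D : (p : M) → Submodule ℝ (TangentSpace (𝓡 n) p)) (y : Euc n) : Submodule ℝ (Euc n) :=
  (D (e.symm y)).map (mfderiv (𝓡 n) (𝓡 n) e (e.symm y)).toLinearMap

/-- The chart expression of a parallel difference tensor that splits along `T`, `D₂` and `D₃`. -/
theorem eigenSplitting_chart {n₁ n₂ : ℕ} (hn : 1 + n₁ + n₂ = n) (hn₁ : 1 ≤ n₁) (hn₂ : 1 ≤ n₂)
    {ε : ℝ} {ψ : M → Euc (n + 1)} (hψ : IsLocallyStronglyConvex ε ψ)
    (hK : HasParallelDifferenceTensor ε ψ) {T : (p : M) → TangentSpace (𝓡 n) p}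
    (hT : ContMDiff (𝓡 n) (𝓡 n).tangent ∞ (fun p => (⟨p, T p⟩ : TangentBundle (𝓡 n) M)))
    {D₂ D₃ : (p : M) → Submodule ℝ (TangentSpace (𝓡 n) p)}
    (hD₂ : ∀ p, Module.finrank ℝ (D₂ p) = n₁) (hD₃ : ∀ p, Module.finrank ℝ (D₃ p) = n₂)
    {l₁ l₂ l₃ : ℝ} (h₁₂ : l₁ ≠ 2 * l₂) (h₁₃ : l₁ ≠ 2 * l₃) (h₂₃ : l₂ ≠ l₃)
    {e : OpenPartialHomeomorph M (Euc n)} (he : e ∈ atlas (Euc n) M)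
    (hTT : ∀ p ∈ e.source, metricAt ε ψ e p (T p) (T p) = 1)
    (hTV : ∀ p ∈ e.source, ∀ V ∈ D₂ p, metricAt ε ψ e p (T p) V = 0)
    (hTW : ∀ p ∈ e.source, ∀ W ∈ D₃ p, metricAt ε ψ e p (T p) W = 0)
    (hVW : ∀ p ∈ e.source, ∀ V ∈ D₂ p, ∀ W ∈ D₃ p, metricAt ε ψ e p V W = 0)
    (hK₁ : ∀ p ∈ e.source, DifferenceTensorEq ε ψ e p (T p) (T p) (l₁ • T p))
    (hK₂ : ∀ p ∈ e.source, ∀ V ∈ D₂ p, DifferenceTensorEq ε ψ e p (T p) V (l₂ • V))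
    (hK₃ : ∀ p ∈ e.source, ∀ W ∈ D₃ p, DifferenceTensorEq ε ψ e p (T p) W (l₃ • W)) :
    EigenSplitting ε (ψ ∘ e.symm) e.target
      (fun y => (mfderiv (𝓡 n) (𝓡 n) e (e.symm y) (T (e.symm y)) : Euc n))
      (chartDistribution e D₂) (chartDistribution e D₃) n₁ n₂ l₁ l₂ l₃ := by
  have : IsManifold (𝓡 n) 1 M := .of_le (n := ∞) (by simp)
  have hmd := mdifferentiable_of_mem_atlas (I := 𝓡 n) he
  have hmetric : ∀ y ∈ e.target, ∀ a b : Euc n,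
      metric ε (ψ ∘ e.symm) y a b = metric ε (ψ ∘ e.symm) (e (e.symm y)) a b :=
    fun y hy a b => by rw [e.right_inv hy]
  have hdiff : ∀ y ∈ e.target, ∀ a b : Euc n, difference ε (ψ ∘ e.symm) y a b =
      differenceTensor ε (ψ ∘ e.symm) (e (e.symm y)) a b :=
    fun y hy a b => by rw [e.right_inv hy, difference_apply]
  have hrank : ∀ y ∈ e.target, ∀ D : (p : M) → Submodule ℝ (TangentSpace (𝓡 n) p),
      Module.finrank ℝ (chartDistribution e D y) = Module.finrank ℝ (D (e.symm y)) :=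
    fun y hy D => (Submodule.equivMapOfInjective _
      (hmd.mfderiv_injective (e.map_target hy)) (D (e.symm y))).finrank_eq.symm
  refine { hψ.convexParam he with
    sign := hψ.sign
    parallel := fun y hy u v w => hK e he y hy u v w
    smooth_field := contDiffOn_chart_field hT he
    dim := hn
    pos₁ := hn₁
    pos₂ := hn₂
    finrank₂ := fun y hy => (hrank y hy _).trans (hD₂ _)
    finrank₃ := fun y hy => (hrank y hy _).trans (hD₃ _)
    unit := fun y hy => (hmetric y hy _ _).trans (hTT _ (e.map_target hy))
    orth₂ := ?_
    orth₃ := ?_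
    orth₂₃ := ?_
    eigen₁ := fun y hy => ?_
    eigen₂ := ?_
    eigen₃ := ?_
    ne₁₂ := h₁₂
    ne₁₃ := h₁₃
    ne₂₃ := h₂₃ }
  · rintro y hy _ ⟨V, hV, rfl⟩
    exact (hmetric y hy _ _).trans (hTV _ (e.map_target hy) V hV)
  · rintro y hy _ ⟨W, hW, rfl⟩
    exact (hmetric y hy _ _).trans (hTW _ (e.map_target hy) W hW)
  · rintro y hy _ ⟨V, hV, rfl⟩ _ ⟨W, hW, rfl⟩
    exact (hmetric y hy _ _).trans (hVW _ (e.map_target hy) V hV W hW)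
  · exact (hdiff y hy _ _).trans ((hK₁ _ (e.map_target hy)).trans (map_smul _ _ _))
  · rintro y hy _ ⟨V, hV, rfl⟩
    exact (hdiff y hy _ _).trans ((hK₂ _ (e.map_target hy) V hV).trans (map_smul _ _ _))
  · rintro y hy _ ⟨W, hW, rfl⟩
    exact (hdiff y hy _ _).trans ((hK₃ _ (e.map_target hy) W hW).trans (map_smul _ _ _))

theorem EigenSplitting.isCalabiProductNear {ε : ℝ} {ψ : M → Euc (n + 1)} {x : M}
    {τ : Euc n → Euc n} {D₂ D₃ : Euc n → Submodule ℝ (Euc n)} {n₁ n₂ : ℕ} {l₁ l₂ l₃ : ℝ}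
    (S : EigenSplitting ε (ψ ∘ (chartAt (Euc n) x).symm) (chartAt (Euc n) x).target τ D₂ D₃
      n₁ n₂ l₁ l₂ l₃) : IsCalabiProductNear n₁ n₂ (-(l₃ / l₂)) ψ x := by
  set e := chartAt (Euc n) x
  have he : e ∈ atlas (Euc n) M := chart_mem_atlas _ _
  have hx : x ∈ e.source := mem_chart_source _ x
  -- Shrinking to a ball supplies the convexity needed for B to be constant and for the potential of
  -- τ.
  obtain ⟨ρ, hρ, hball⟩ := Metric.isOpen_iff.1 e.open_target (e x) (e.map_source hx)
  obtain ⟨J, U₁, U₂, G₁, G₂, ε₁, ε₂, A, Ψ, hJ, h₁, h₂, hsource, htarget, hmem, hs, hs', heq⟩ :=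
    (S.mono Metric.isOpen_ball hball).exists_calabi_coordinates (convex_ball _ _)
      (Metric.mem_ball_self hρ)
  have hmaps : ∀ z ∈ Ψ.source, Ψ z ∈ e.target := fun z hz => hball (htarget (Ψ.map_source hz))
  have hΦ : (Ψ.trans e.symm).source = Ψ.source := by
    rw [OpenPartialHomeomorph.trans_source]
    exact Set.inter_eq_left.2 hmaps
  have hΦt : ∀ p ∈ (Ψ.trans e.symm).target, p ∈ e.source ∧ e p ∈ Ψ.target := fun p hp => by
    rw [OpenPartialHomeomorph.trans_target] at hp
    exact hp
  have hsm : ContMDiffOn (𝓡 n) (𝓡 n) ∞ e e.source :=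
    contMDiffOn_of_mem_maximalAtlas (IsManifold.subset_maximalAtlas he)
  have hsymm : ContMDiffOn (𝓡 n) (𝓡 n) ∞ e.symm e.target :=
    contMDiffOn_symm_of_mem_maximalAtlas (IsManifold.subset_maximalAtlas he)
  have hP₁ := ParallelConvexParam.opens (U := ⟨U₁, h₁.isOpen⟩) h₁
  have hP₂ := ParallelConvexParam.opens (U := ⟨U₂, h₂.isOpen⟩) h₂
  refine ⟨⟨J, hJ⟩, ⟨U₁, h₁.isOpen⟩, ⟨U₂, h₂.isOpen⟩, fun p => G₁ p, fun q => G₂ q, ε₁, ε₂, A,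
    Ψ.trans e.symm, hP₁.1, hP₁.2, hP₂.1, hP₂.2, ?_, ?_, ?_, hΦ.trans hsource,
    fun u hu p q => heq u hu p p.2 q q.2⟩
  · rw [hΦ]
    exact hsymm.comp (contMDiffOn_iff_contDiffOn.2 hs) hmaps
  · exact (contMDiffOn_iff_contDiffOn.2 hs').comp (hsm.mono fun p hp => (hΦt p hp).1)
      fun p hp => (hΦt p hp).2
  · rw [OpenPartialHomeomorph.trans_target]
    exact ⟨hx, hmem⟩

end ChartSplitting

end Centroaffine

theorem theorem3p2 {n n₁ n₂ : ℕ} (hn : 1 + n₁ + n₂ = n) (hn₁ : 1 ≤ n₁) (hn₂ : 1 ≤ n₂)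
    {M : Type*} [TopologicalSpace M] [ChartedSpace (Centroaffine.Euc n) M] [IsManifold (𝓡 n) ∞ M]
    (ε : ℝ) (ψ : M → Centroaffine.Euc (n + 1))
    (hψ : Centroaffine.IsLocallyStronglyConvex ε ψ)
    (hK : Centroaffine.HasParallelDifferenceTensor ε ψ)
    (T : (p : M) → TangentSpace (𝓡 n) p)
    (hT : ContMDiff (𝓡 n) (𝓡 n).tangent ∞ (fun p => (⟨p, T p⟩ : TangentBundle (𝓡 n) M)))
    (D₂ D₃ : (p : M) → Submodule ℝ (TangentSpace (𝓡 n) p))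
    (hD₂ : ∀ p, Module.finrank ℝ (D₂ p) = n₁) (hD₃ : ∀ p, Module.finrank ℝ (D₃ p) = n₂)
    (hTT : ∀ e ∈ atlas (Centroaffine.Euc n) M, ∀ p ∈ e.source,
      Centroaffine.metricAt ε ψ e p (T p) (T p) = 1)
    (hTV : ∀ e ∈ atlas (Centroaffine.Euc n) M, ∀ p ∈ e.source, ∀ V ∈ D₂ p,
      Centroaffine.metricAt ε ψ e p (T p) V = 0)
    (hTW : ∀ e ∈ atlas (Centroaffine.Euc n) M, ∀ p ∈ e.source, ∀ W ∈ D₃ p,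
      Centroaffine.metricAt ε ψ e p (T p) W = 0)
    (hVW : ∀ e ∈ atlas (Centroaffine.Euc n) M, ∀ p ∈ e.source, ∀ V ∈ D₂ p, ∀ W ∈ D₃ p,
      Centroaffine.metricAt ε ψ e p V W = 0)
    (l₁ l₂ l₃ : ℝ)
    (hK₁ : ∀ e ∈ atlas (Centroaffine.Euc n) M, ∀ p ∈ e.source,
      Centroaffine.DifferenceTensorEq ε ψ e p (T p) (T p) (l₁ • T p))
    (hK₂ : ∀ e ∈ atlas (Centroaffine.Euc n) M, ∀ p ∈ e.source, ∀ V ∈ D₂ p,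
      Centroaffine.DifferenceTensorEq ε ψ e p (T p) V (l₂ • V))
    (hK₃ : ∀ e ∈ atlas (Centroaffine.Euc n) M, ∀ p ∈ e.source, ∀ W ∈ D₃ p,
      Centroaffine.DifferenceTensorEq ε ψ e p (T p) W (l₃ • W))
    (h₁₂ : l₁ ≠ 2 * l₂) (h₁₃ : l₁ ≠ 2 * l₃) (h₂₃ : l₂ ≠ l₃) :
    ∃ lam : ℝ, lam ≠ 0 ∧ lam ≠ -1 ∧
      ∀ x : M, Centroaffine.IsCalabiProductNear n₁ n₂ lam ψ x := by
  have S := fun x : M => Centroaffine.eigenSplitting_chart hn hn₁ hn₂ hψ hK hT hD₂ hD₃ h₁₂ h₁₃ h₂₃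
    (chart_mem_atlas (Centroaffine.Euc n) x) (hTT _ (chart_mem_atlas _ x))
    (hTV _ (chart_mem_atlas _ x)) (hTW _ (chart_mem_atlas _ x)) (hVW _ (chart_mem_atlas _ x))
    (hK₁ _ (chart_mem_atlas _ x)) (hK₂ _ (chart_mem_atlas _ x)) (hK₃ _ (chart_mem_atlas _ x))
  rcases isEmpty_or_nonempty M with hM | ⟨⟨x⟩⟩
  · exact ⟨1, one_ne_zero, by norm_num, fun x => (hM.false x).elim⟩
  · have hx := mem_chart_target (Centroaffine.Euc n) x
    have hl₂ := (S x).eigenvalue_ne_zero hx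
    have hl₃ := (S x).swap.eigenvalue_ne_zero hx
    -- λ depends only on the constants λᵢ, so one value serves every point. It is nonzero because
    -- λ₂λ₃ = ε, and λ = −1 would force λ₂ = λ₃.
    refine ⟨-(l₃ / l₂), neg_ne_zero.2 (div_ne_zero hl₃ hl₂), fun h => h₂₃ ?_,
      fun y => (S y).isCalabiProductNear⟩
    rw [neg_inj, div_eq_one_iff_eq hl₂] at h
    exact h.symm
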